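/- Let $d\in\mathbb N$, $\mu>0$, $0<T<\infty$, and $\mathbb T^d=(\mathbb R/\mathbb Z)^d$. Let $u_0\in L^2(\mathbb T^d;\mathbb R^d)$ be divergence-free in the sense of distributions. Let $u\in L^\infty(0,T;L^2(\mathbb T^d;\mathbb R^d))\cap L^2(0,T;H^1(\mathbb T^d;\mathbb R^d))$ be a weak solution of the incompressible Navier–Stokes equations $u_t+u\cdot\nabla u+\nabla P-\mu\Delta u=0$, $\operatorname{div}u=0$, with initial datum $u_0$; that is, $\operatorname{div}u(t)=0$ in the sense of distributions for almost every $t\in(0,T)$, and $$-\int_0^T\!\!\int_{\mathbb T^d}u\cdot\varphi_t\,dx\,dt-\int_{\mathbb T^d}u_0\cdot\varphi(0,x)\,dx-\int_0^T\!\!\int_{\mathbb T^d}\sum_{i,j}u_iu_j\,\partial_i\varphi_j\,dx\,dt+\mu\int_0^T\!\!\int_{\mathbb T^d}\nabla u:\nabla\varphi\,dx\,dt=0$$ for every smooth vector field $\varphi$ with compact support in $[0,T)\times\mathbb T^d$ and $\operatorname{div}\varphi=0$. Suppose in addition that, for some $r,s\in(0,\infty]$ with $$\frac1r+\frac1s\le\frac12,\qquad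 s\ge4$$ (where $1/\infty=0$), one has $u\in L^r(0,T;L^s(\mathbb T^d))$, that is, the function $t\mapsto\|u(t)\|_{L^s(\mathbb T^d)}$ has finite $L^r(0,T)$ norm. Then $u$ agrees for almost every $t\in(0,T)$ with a function that is weakly continuous from $[0,T]$ to $L^2(\mathbb T^d;\mathbb R^d)$, and this representative, again denoted by $u$, satisfies $u(0)=u_0$ and $$\int_{\mathbb T^d}|u(t,x)|^2\,dx+2\mu\int_0^t\!\!\int_{\mathbb T^d}|\nabla u|^2\,dx\,d\tau=\int_{\mathbb T^d}|u_0|^2\,dx\qquad\text{for every }t\in[0,T].$$ -/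

import Mathlib

open MeasureTheory Set
open scoped ENNReal ContDiff RealInnerProductSpace

noncomputable section

namespace NavierStokes

/-- Vectors in `ℝ^d` with the Euclidean norm. -/
abbrev Vec (d : ℕ) : Type := EuclideanSpace ℝ (Fin d)

/-- The torus `𝕋^d = (ℝ/ℤ)^d`; its `volume` is the normalized Haar (Lebesgue) measure. -/
abbrev Torus (d : ℕ) : Type := UnitAddTorus (Fin d)

/-- The space `L²(𝕋^d; ℝ^d)` of vector fields. -/
abbrev L2 (d : ℕ) : Type := Lp (Vec d) 2 (volume : Measure (Torus d))

/-- The projection `ℝ^d → 𝕋^d`. -/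
def toTorus {d : ℕ} (y : Fin d → ℝ) : Torus d := fun i => (y i : UnitAddCircle)

/-- The classical partial derivative `∂_i f` of a function on the torus. -/
def partialDeriv {d : ℕ} {F : Type*} [NormedAddCommGroup F] [NormedSpace ℝ F]
    (i : Fin d) (f : Torus d → F) (x : Torus d) : F :=
  deriv (fun h : ℝ => f (x + Pi.single i (h : UnitAddCircle))) 0

/-- `ψ ∈ C^∞(𝕋^d)`: the periodic lift of `ψ` to `ℝ^d` is smooth. -/
def IsSmooth {d : ℕ} (ψ : Torus d → ℝ) : Prop :=
  ContDiff ℝ ∞ (fun y : Fin d → ℝ => ψ (toTorus y))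

/-- `div f = 0` in the sense of distributions. -/
def IsDivFree {d : ℕ} (f : L2 d) : Prop :=
  ∀ ψ : Torus d → ℝ, IsSmooth ψ → ∫ x, ∑ i, f x i * partialDeriv i ψ x = 0

/-- `g ∈ L²` is the weak partial derivative `∂_i f` of `f ∈ L²`. -/
def IsWeakPartialDeriv {d : ℕ} (i : Fin d) (f g : L2 d) : Prop :=
  ∀ ψ : Torus d → ℝ, IsSmooth ψ →
    ∫ x, partialDeriv i ψ x • f x = -∫ x, ψ x • g x

/-- `u ∈ L^∞(0,T;L²(𝕋^d))`, in the Bochner sense. -/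
def MemLinftyL2 {d : ℕ} (T : ℝ) (u : ℝ → L2 d) : Prop :=
  MemLp u ⊤ (volume.restrict (Ioo 0 T))

/-- `u ∈ L²(0,T;H¹(𝕋^d))` with weak spatial gradient `∇u = G`, where `G t i = ∂_i u(t)`. -/
structure MemL2H1 {d : ℕ} (T : ℝ) (u : ℝ → L2 d) (G : ℝ → Fin d → L2 d) : Prop where
  memLp : MemLp u 2 (volume.restrict (Ioo 0 T))
  grad_memLp : ∀ i, MemLp (fun t => G t i) 2 (volume.restrict (Ioo 0 T))
  isWeakPartialDeriv :
    ∀ᵐ t ∂(volume.restrict (Ioo 0 T)), ∀ i, IsWeakPartialDeriv i (u t) (G t i)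

/-- The mixed-norm condition `u ∈ L^r(0,T;L^s(𝕋^d))`, that is,
`t ↦ ‖u(t)‖_{L^s}` has finite `L^r(0,T)` norm. For `u` strongly measurable into `L²` the function
`t ↦ ‖u(t)‖_{L^s}` is automatically measurable, being a lower semicontinuous function of `u(t)`. -/
def MemLrLs {d : ℕ} (T : ℝ) (r s : ℝ≥0∞) (u : ℝ → L2 d) : Prop :=
  eLpNorm (fun t => eLpNorm (u t) s (volume : Measure (Torus d))) r
    (volume.restrict (Ioo 0 T)) < ⊤

/-- Divergence-free vector test functions, smooth and compactly supported in `[0,T) × 𝕋^d`.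
(A smooth function on `[0,T) × 𝕋^d`, up to `t = 0`, is the restriction of one that is smooth for all
times, and the values at negative times play no role.) -/
structure IsTestField {d : ℕ} (T : ℝ) (φ : ℝ → Torus d → Vec d) : Prop where
  smooth : ContDiff ℝ ∞ (fun p : ℝ × (Fin d → ℝ) => φ p.1 (toTorus p.2))
  support : ∃ T' < T, ∀ t, T' ≤ t → ∀ x, φ t x = 0
  divFree : ∀ t x, ∑ i, partialDeriv i (fun z => φ t z i) x = 0

/-- `u ∈ L^∞(0,T;L²) ∩ L²(0,T;H¹)`, with weak spatial gradient `G`, is a weak solution on `(0,T)` of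
`u_t + u·∇u + ∇P - μ Δu = 0`, `div u = 0`, with divergence-free initial datum `u₀ ∈ L²`. -/
structure IsWeakSolution {d : ℕ} (μ T : ℝ) (u₀ : L2 d) (u : ℝ → L2 d)
    (G : ℝ → Fin d → L2 d) : Prop where
  memLinftyL2 : MemLinftyL2 T u
  memL2H1 : MemL2H1 T u G
  initial_divFree : IsDivFree u₀
  divFree : ∀ᵐ t ∂(volume.restrict (Ioo 0 T)), IsDivFree (u t)
  weak_form : ∀ φ : ℝ → Torus d → Vec d, IsTestField T φ →
    -(∫ t in Ioo 0 T, ∫ x, ⟪u t x, deriv (fun τ => φ τ x) t⟫)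
      - (∫ x, ⟪u₀ x, φ 0 x⟫)
      - (∫ t in Ioo 0 T, ∫ x, ∑ i, ∑ j, u t x i * u t x j * partialDeriv i (φ t) x j)
      + μ * (∫ t in Ioo 0 T, ∫ x, ∑ i, ⟪G t i x, partialDeriv i (φ t) x⟫) = 0

/-- `v` is a weakly continuous representative of `u`: it equals `u` at almost every time in `(0,T)`
and `t ↦ v(t)` is continuous from `[0,T]` to `L²(𝕋^d)` with its weak topology. -/
structure IsWeaklyContinuousRep {d : ℕ} (T : ℝ) (u v : ℝ → L2 d) : Prop where
  ae_eq : ∀ᵐ t ∂(volume.restrict (Ioo 0 T)), v t = u t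
  weak_continuous : ∀ w : L2 d, ContinuousOn (fun t => ⟪v t, w⟫) (Icc 0 T)

end NavierStokes

end

open Filter Topology

namespace NavierStokes


/-! Expand everything in real trigonometric modes. Testing the equation with `η(t) • trig k b • a`,
where `a` is orthogonal to `k`, removes the pressure and shows that each coefficient of `u` is a.e.
the primitive of a function in `L¹(0,T)` (`IsWeakSolution.ae_trigCoeff_eq`). The modes span `L²` and
`u` is bounded in `L²`, so these continuous coefficients assemble into a weakly continuous
representative (`exists_weaklyContinuous_rep`), whose coefficients at time `0` are those of `u₀`.

For a single frequency the energy balance is the product rule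
(`IsWeakSolution.sum_evolvedCoeff_sq`). The difficulty is the sum over frequencies. Interpolation
between `L^∞L²` and `L^rL^s` puts `u` in `L⁴((0,T) × 𝕋^d)` (`lintegral_lintegral_pow_four_lt_top`),
so `uᵢuⱼ` is square integrable and can be paired with `∂ᵢuⱼ` by Parseval. Hence the series of energy
rates converges absolutely in `L¹(0,T)`, and summation commutes with time integration
(`IsWeakSolution.hasSum_integral_energyRate`). At a.e. time its sum is `∑ ∫ uᵢuⱼ∂ᵢuⱼ - μ ∑ ‖∂ᵢu‖²`.
The cubic term vanishes because `div u = 0` and the integral converges absolutely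
(`IsDivFree.integral_mul_mul_eq_zero`). -/

/-! ### The real trigonometric system and its derivatives. -/

/-- The real trigonometric system on the torus: `cos (2π k·x)` and `sin (2π k·x)`. -/
noncomputable def trig {d : ℕ} (k : Fin d → ℤ) (b : Bool) (x : Torus d) : ℝ :=
  cond b (UnitAddTorus.mFourier k x).im (UnitAddTorus.mFourier k x).re

/-- The factor in `∂_i (trig k b) = freq k b i * trig k (!b)`. -/
noncomputable def freq {d : ℕ} (k : Fin d → ℤ) (b : Bool) (i : Fin d) : ℝ :=
  cond b (2 * Real.pi * k i) (-(2 * Real.pi * k i))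

variable {d : ℕ}

lemma freq_not (k : Fin d → ℤ) (b : Bool) (i : Fin d) : freq k (!b) i = -freq k b i := by
  cases b <;> simp [freq]

lemma continuous_trig (k : Fin d → ℤ) (b : Bool) : Continuous (trig k b) := by
  cases b
  · exact Complex.continuous_re.comp (UnitAddTorus.mFourier k).continuous
  · exact Complex.continuous_im.comp (UnitAddTorus.mFourier k).continuous

lemma abs_trig_le_one (k : Fin d → ℤ) (b : Bool) (x : Torus d) : |trig k b x| ≤ 1 := by
  have h : ‖UnitAddTorus.mFourier k x‖ ≤ 1 :=
    ((UnitAddTorus.mFourier k).norm_coe_le_norm x).trans_eq UnitAddTorus.mFourier_norm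
  cases b
  · exact (Complex.abs_re_le_norm _).trans h
  · exact (Complex.abs_im_le_norm _).trans h

lemma mFourier_add_single (k : Fin d → ℤ) (x : Torus d) (i : Fin d) (h : ℝ) :
    UnitAddTorus.mFourier k (x + Pi.single i (h : UnitAddCircle))
      = Complex.exp (2 * Real.pi * Complex.I * k i * h) * UnitAddTorus.mFourier k x := by
  have h1 : ∀ j, (fourier (k j) ((x + Pi.single i (h : UnitAddCircle) : Torus d) j) : ℂ)
      = (fourier (k j) ((Pi.single i (h : UnitAddCircle) : Torus d) j) : ℂ)
        * fourier (k j) (x j) := by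
    intro j
    simp [fourier_apply, smul_add, AddCircle.toCircle_add, mul_comm]
  simp only [UnitAddTorus.mFourier, ContinuousMap.coe_mk, h1, Finset.prod_mul_distrib]
  congr 1
  rw [Finset.prod_eq_single i]
  · rw [Pi.single_eq_same, fourier_coe_apply]; simp
  · intro j _ hj
    rw [Pi.single_eq_of_ne hj, fourier_eval_zero]
  · simp

lemma hasDerivAt_trig (k : Fin d → ℤ) (b : Bool) (i : Fin d) (x : Torus d) :
    HasDerivAt (fun h : ℝ => trig k b (x + Pi.single i (h : UnitAddCircle)))
      (freq k b i * trig k (!b) x) 0 := by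
  have h0 : HasDerivAt (fun h : ℝ => UnitAddTorus.mFourier k (x + Pi.single i (h : UnitAddCircle)))
      (2 * Real.pi * Complex.I * k i * UnitAddTorus.mFourier k x) 0 := by
    simp only [mFourier_add_single]
    have h1 : HasDerivAt (fun h : ℝ => 2 * Real.pi * Complex.I * k i * (h : ℂ))
        (2 * Real.pi * Complex.I * k i) 0 := by
      simpa using (Complex.ofRealCLM.hasDerivAt (x := (0 : ℝ))).const_mul
        (2 * Real.pi * Complex.I * k i)
    simpa using (h1.cexp).mul_const (UnitAddTorus.mFourier k x)
  cases b
  · have := (Complex.reCLM.hasFDerivAt.comp_hasDerivAt (0 : ℝ) h0)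
    refine this.congr_deriv ?_
    simp [trig, freq]
  · have := (Complex.imCLM.hasFDerivAt.comp_hasDerivAt (0 : ℝ) h0)
    refine this.congr_deriv ?_
    simp [trig, freq]

lemma partialDeriv_trig (k : Fin d → ℤ) (b : Bool) (i : Fin d) (x : Torus d) :
    partialDeriv i (trig k b) x = freq k b i * trig k (!b) x :=
  (hasDerivAt_trig k b i x).deriv

lemma isSmooth_trig (k : Fin d → ℤ) (b : Bool) : IsSmooth (trig k b) := by
  have h : ContDiff ℝ ∞ (fun y : Fin d → ℝ => UnitAddTorus.mFourier k (toTorus y)) := by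
    have : (fun y : Fin d → ℝ => UnitAddTorus.mFourier k (toTorus y))
        = fun y => ∏ j, Complex.exp (2 * Real.pi * Complex.I * k j * (y j : ℂ)) := by
      funext y
      simp [UnitAddTorus.mFourier, toTorus]
    rw [this]
    refine contDiff_prod fun j _ => ContDiff.cexp (contDiff_const.mul ?_)
    exact Complex.ofRealCLM.contDiff.comp (contDiff_apply ℝ ℝ j)
  cases b
  · exact Complex.reCLM.contDiff.comp h
  · exact Complex.imCLM.contDiff.comp h

/-! ### Trigonometric coefficients and Parseval's identity. -/

/-- The coefficients of a function in the real trigonometric system. -/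
noncomputable def trigCoeff (k : Fin d → ℤ) (b : Bool) (f : Torus d → ℝ) : ℝ :=
  ∫ x, f x * trig k b x

/-- Mathlib's Fourier theory on `UnitAddTorus` uses the product of Haar probability measures; this
transfers it to `volume`. -/
lemma volume_torus_eq_pi_haar :
    (volume : Measure (Torus d)) = Measure.pi fun _ => (AddCircle.haarAddCircle : Measure UnitAddCircle) := by
  have : (volume : Measure UnitAddCircle) = AddCircle.haarAddCircle := by
    rw [AddCircle.volume_eq_smul_haarAddCircle]; simp
  rw [← this]; rfl

lemma mFourier_neg_eq (k : Fin d → ℤ) (x : Torus d) :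
    UnitAddTorus.mFourier (-k) x = trig k false x - Complex.I * trig k true x := by
  rw [UnitAddTorus.mFourier_neg]
  apply Complex.ext <;> simp [trig]

lemma memLp_trig (k : Fin d → ℤ) (b : Bool) (p : ℝ≥0∞) : MemLp (trig k b) p :=
  (MemLp.of_bound (continuous_trig k b).aestronglyMeasurable 1
    (Eventually.of_forall fun x => abs_trig_le_one k b x))

lemma integrable_mul_trig {f : Torus d → ℝ} (hf : Integrable f) (k : Fin d → ℤ) (b : Bool) :
    Integrable fun x => f x * trig k b x :=
  hf.mul_bdd (c := 1) (continuous_trig k b).aestronglyMeasurable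
    (Eventually.of_forall fun x => abs_trig_le_one k b x)

lemma integral_mFourier_neg_mul {f : Torus d → ℝ} (hf : Integrable f) (k : Fin d → ℤ) :
    ∫ x, UnitAddTorus.mFourier (-k) x * (f x : ℂ)
      = trigCoeff k false f - Complex.I * trigCoeff k true f := by
  have h : ∀ x, UnitAddTorus.mFourier (-k) x * (f x : ℂ)
      = ((f x * trig k false x : ℝ) : ℂ) - Complex.I * ((f x * trig k true x : ℝ) : ℂ) := by
    intro x; rw [mFourier_neg_eq]; push_cast; ring
  simp only [h, trigCoeff]
  rw [integral_sub (integrable_mul_trig hf k false).ofReal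
    ((integrable_mul_trig hf k true).ofReal.const_mul _), integral_const_mul,
    integral_complex_ofReal, integral_complex_ofReal]

/-- Mathlib's Parseval identity, for the measure `volume` on the torus. -/
lemma hasSum_mFourierCoeff {f g : Torus d → ℂ} (hf : MemLp f 2) (hg : MemLp g 2) :
    HasSum (fun k => starRingEnd ℂ (∫ x, UnitAddTorus.mFourier (-k) x * f x)
      * (∫ x, UnitAddTorus.mFourier (-k) x * g x)) (∫ x, starRingEnd ℂ (f x) * g x) := by
  rw [volume_torus_eq_pi_haar] at *
  have key := UnitAddTorus.hasSum_prod_mFourierCoeff (hf.toLp f) (hg.toLp g)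
  have e1 := hf.coeFn_toLp
  have e2 := hg.coeFn_toLp
  convert! key using 1
  · funext k
    congr 1
    · congr 1
      apply integral_congr_ae
      filter_upwards [e1] with x hx using by rw [hx, smul_eq_mul]
    · apply integral_congr_ae
      filter_upwards [e2] with x hx using by rw [hx, smul_eq_mul]
  · apply integral_congr_ae
    filter_upwards [e1, e2] with x hx hx' using by rw [hx, hx']

/-- Real part of the complex identity. No normalising constant appears: for `k ≠ 0` the frequencies
`k` and `-k` repeat the same functions up to sign, which offsets `‖cos‖² = ‖sin‖² = 1/2`. -/
lemma hasSum_trigCoeff_mul {f g : Torus d → ℝ} (hf : MemLp f 2) (hg : MemLp g 2) :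
    HasSum (fun k => ∑ b, trigCoeff k b f * trigCoeff k b g) (∫ x, f x * g x) := by
  have key := Complex.reCLM.hasSum (hasSum_mFourierCoeff hf.ofReal hg.ofReal)
  convert! key using 1
  · funext k
    erw [integral_mFourier_neg_mul (hf.integrable (by norm_num)) k,
      integral_mFourier_neg_mul (hg.integrable (by norm_num)) k]
    simp
    ring
  · simp only [RCLike.ofReal]
    have : ∀ x, starRingEnd ℂ ((f x : ℂ)) * (g x : ℂ) = ((f x * g x : ℝ) : ℂ) := by
      intro x; simp
    erw [integral_congr_ae (Eventually.of_forall this), integral_complex_ofReal]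
    simp

lemma hasSum_trigCoeff_sq {f : Torus d → ℝ} (hf : MemLp f 2) :
    HasSum (fun k => ∑ b, trigCoeff k b f ^ 2) (∫ x, f x ^ 2) := by
  simpa only [sq] using hasSum_trigCoeff_mul hf hf


/-! ### Fourier partial sums. -/

/-- The Fourier partial sum over the frequencies in `F`. -/
noncomputable def trigSum (F : Finset (Fin d → ℤ)) (h : Torus d → ℝ) (x : Torus d) : ℝ :=
  ∑ k ∈ F, ∑ b, trigCoeff k b h * trig k b x

lemma tendsto_eLpNorm_mFourier_sum {f : Torus d → ℂ} (hf : MemLp f 2) :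
    Tendsto (fun F : Finset (Fin d → ℤ) => eLpNorm (fun x => ∑ k ∈ F,
      (∫ y, UnitAddTorus.mFourier (-k) y * f y) * UnitAddTorus.mFourier k x - f x) 2 volume)
      atTop (𝓝 0) := by
  rw [volume_torus_eq_pi_haar] at *
  have key := UnitAddTorus.hasSum_mFourier_series_L2 (hf.toLp f)
  have e1 := hf.coeFn_toLp
  have h1 : ∀ k, UnitAddTorus.mFourierCoeff (hf.toLp f) k
      = ∫ y, UnitAddTorus.mFourier (-k) y * f y
        ∂(Measure.pi fun _ => (AddCircle.haarAddCircle : Measure UnitAddCircle)) := by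
    intro k
    apply integral_congr_ae
    filter_upwards [e1] with x hx using by rw [hx, smul_eq_mul]
  rw [HasSum, SummationFilter.unconditional_filter, Lp.tendsto_Lp_iff_tendsto_eLpNorm'] at key
  refine key.congr fun F => eLpNorm_congr_ae ?_
  have h2 : ∑ k ∈ F, UnitAddTorus.mFourierCoeff (hf.toLp f) k • UnitAddTorus.mFourierLp 2 k
      = ContinuousMap.toLp (E := ℂ) 2
        (Measure.pi fun _ => (AddCircle.haarAddCircle : Measure UnitAddCircle)) ℂ
        (∑ k ∈ F, UnitAddTorus.mFourierCoeff (hf.toLp f) k • UnitAddTorus.mFourier k) := by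
    simp only [map_sum, map_smul]; rfl
  rw [h2]
  filter_upwards [e1, ContinuousMap.coeFn_toLp (p := 2) (𝕜 := ℂ)
    (Measure.pi fun _ => (AddCircle.haarAddCircle : Measure UnitAddCircle))
    (∑ k ∈ F, UnitAddTorus.mFourierCoeff (hf.toLp f) k • UnitAddTorus.mFourier k)] with x hx hx'
  erw [Pi.sub_apply, hx, hx']
  simp [h1]

/-- Each real term is the real part of the complex term of the same frequency, so `F` need not be
symmetric under `k ↦ -k`. -/
lemma tendsto_eLpNorm_trigSum_sub {h : Torus d → ℝ} (hh : MemLp h 2) :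
    Tendsto (fun F => eLpNorm (fun x => trigSum F h x - h x) 2 volume) atTop (𝓝 0) := by
  refine tendsto_of_tendsto_of_tendsto_of_le_of_le tendsto_const_nhds
    (tendsto_eLpNorm_mFourier_sum hh.ofReal) (fun _ => zero_le) fun F => ?_
  refine eLpNorm_mono fun x => ?_
  refine le_trans (le_of_eq ?_) (Complex.abs_re_le_norm _)
  rw [Real.norm_eq_abs]
  congr 1
  have e : ∀ k : Fin d → ℤ, (∫ y, UnitAddTorus.mFourier (-k) y * RCLike.ofReal (K := ℂ) (h y))
      = trigCoeff k false h - Complex.I * trigCoeff k true h :=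
    fun k => integral_mFourier_neg_mul (hh.integrable (by norm_num)) k
  simp only [e, Complex.sub_re, Complex.re_sum, trigSum]
  congr 1
  refine Finset.sum_congr rfl fun k _ => ?_
  simp [trig]
  ring

lemma isSmooth_trigSum (F : Finset (Fin d → ℤ)) (h : Torus d → ℝ) : IsSmooth (trigSum F h) := by
  unfold IsSmooth trigSum
  exact ContDiff.sum fun k _ => ContDiff.sum fun b _ => contDiff_const.mul (isSmooth_trig k b)

/-- The hypothesis `hg` says `∂ᵢh = g` on the Fourier side, where differentiation swaps cosine and
sine; truncation therefore commutes with `∂ᵢ` exactly. -/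
lemma hasDerivAt_trigSum (F : Finset (Fin d → ℤ)) {h g : Torus d → ℝ} (i : Fin d)
    (hg : ∀ k b, freq k b i * trigCoeff k b h = trigCoeff k (!b) g) (x : Torus d) :
    HasDerivAt (fun t : ℝ => trigSum F h (x + Pi.single i (t : UnitAddCircle)))
      (trigSum F g x) 0 := by
  unfold trigSum
  refine (HasDerivAt.fun_sum fun k _ => HasDerivAt.fun_sum fun b _ =>
    (hasDerivAt_trig k b i x).const_mul (trigCoeff k b h)).congr_deriv ?_
  refine Finset.sum_congr rfl fun k _ => ?_
  have h0 := hg k false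
  have h1 := hg k true
  simp only [Fintype.sum_bool, Bool.not_true, Bool.not_false] at *
  linear_combination trig k true x * h0 + trig k false x * h1

lemma continuous_trigSum (F : Finset (Fin d → ℤ)) (h : Torus d → ℝ) :
    Continuous (trigSum F h) := by
  unfold trigSum
  exact continuous_finsetSum _ fun k _ => continuous_finsetSum _ fun b _ =>
    continuous_const.mul (continuous_trig k b)


/-! ### Absolutely continuous functions of time. -/

/-- Product rule for absolutely continuous functions. It serves both to identify distributional
derivatives in time and to differentiate the squared coefficients. -/
lemma primitive_mul_primitive {T : ℝ} {p q : ℝ → ℝ} (hp : IntervalIntegrable p volume 0 T)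
    (hq : IntervalIntegrable q volume 0 T) (a b : ℝ) :
    (a + ∫ τ in (0)..T, p τ) * (b + ∫ τ in (0)..T, q τ)
      = a * b + ∫ t in (0)..T, (p t * (b + ∫ τ in (0)..t, q τ) + (a + ∫ τ in (0)..t, p τ) * q t) := by
  have hP := hp.absolutelyContinuousOnInterval_intervalIntegral (c := 0) (by simp)
  have hQ := hq.absolutelyContinuousOnInterval_intervalIntegral (c := 0) (by simp)
  have hc : ∀ c : ℝ, AbsolutelyContinuousOnInterval (fun _ : ℝ => c) 0 T := fun c =>
    (LipschitzWith.const c).lipschitzOnWith.absolutelyContinuousOnInterval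
  have key := ((hc a).fun_add hP).integral_deriv_mul_eq_sub ((hc b).fun_add hQ)
  simp only [intervalIntegral.integral_same, add_zero] at key
  rw [← sub_eq_iff_eq_add', ← key]
  refine intervalIntegral.integral_congr_ae ?_
  filter_upwards [hp.ae_hasDerivAt_integral, hq.ae_hasDerivAt_integral] with t h1 h2 ht
  have ht' := uIoc_subset_uIcc ht
  rw [((h1 ht' 0 (by simp)).const_add a).deriv, ((h2 ht' 0 (by simp)).const_add b).deriv]

lemma continuousOn_primitive_add {T : ℝ} (hT : 0 ≤ T) {q : ℝ → ℝ} (hq : IntegrableOn q (Ioo 0 T))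
    (c : ℝ) : ContinuousOn (fun t => c + ∫ τ in (0)..t, q τ) (Icc 0 T) := by
  have h : IntegrableOn q (Icc 0 T) := by rwa [integrableOn_Icc_iff_integrableOn_Ioo]
  have := intervalIntegral.continuousOn_primitive_interval (a := 0) (b := T) (f := q) (μ := volume)
    (by rwa [uIcc_of_le hT])
  rw [uIcc_of_le hT] at this
  exact continuousOn_const.add this

/-- A function with a distributional derivative in `L¹(0,T)` and initial value `c` is almost
everywhere the primitive of this derivative. -/
lemma ae_eq_primitive_of_weak_form {T : ℝ} (hT : 0 < T) {p q : ℝ → ℝ} {c : ℝ}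
    (hp : IntegrableOn p (Ioo 0 T)) (hq : IntegrableOn q (Ioo 0 T))
    (h : ∀ η : ℝ → ℝ, ContDiff ℝ ∞ η → (∃ T' < T, ∀ t, T' ≤ t → η t = 0) →
      -(∫ t in Ioo 0 T, deriv η t * p t) - η 0 * c - ∫ t in Ioo 0 T, η t * q t = 0) :
    ∀ᵐ t ∂(volume.restrict (Ioo 0 T)), p t = c + ∫ τ in (0)..t, q τ := by
  have hPc := continuousOn_primitive_add hT.le hq c
  have hPi : IntegrableOn (fun t => c + ∫ τ in (0)..t, q τ) (Ioo 0 T) :=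
    (hPc.integrableOn_Icc).mono_set Ioo_subset_Icc_self
  have key := isOpen_Ioo.ae_eq_zero_of_integral_contDiff_smul_eq_zero (μ := volume)
    (f := fun t => p t - (c + ∫ τ in (0)..t, q τ)) (U := Ioo 0 T)
    (hp.sub hPi).locallyIntegrableOn ?_
  · rw [ae_restrict_iff' measurableSet_Ioo]
    filter_upwards [key] with t ht ht' using sub_eq_zero.1 (ht ht')
  intro g hg hgc hgs
  have hgcont : Continuous g := hg.continuous
  have hg0 : ∀ t, t ∉ Ioo 0 T → g t = 0 := fun t ht => image_eq_zero_of_notMem_tsupport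
    fun h' => ht (hgs h')
  have hgi : ∀ a b, IntervalIntegrable g volume a b := fun a b => hgcont.intervalIntegrable a b
  -- The antiderivative of `g` that vanishes near `T` is admissible in `h`. It need not vanish at
  -- `0`, and this is how the initial value `c` enters.
  set η : ℝ → ℝ := fun t => ∫ τ in T..t, g τ with hη
  have hd : ∀ t, HasDerivAt η (g t) t := fun t =>
    intervalIntegral.integral_hasDerivAt_right (hgi _ _)
      (hgcont.stronglyMeasurableAtFilter _ _) hgcont.continuousAt
  have hder : deriv η = g := funext fun t => (hd t).deriv
  have hsmooth : ContDiff ℝ ∞ η := contDiff_infty_iff_deriv.2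
    ⟨fun t => (hd t).differentiableAt, hder ▸ hg⟩
  have hsupp : ∃ T' < T, ∀ t, T' ≤ t → g t = 0 := by
    rcases (tsupport g).eq_empty_or_nonempty with he | hne
    · refine ⟨T - 1, by linarith, fun t _ => image_eq_zero_of_notMem_tsupport (by simp [he])⟩
    · obtain ⟨m, hm, hmax⟩ := hgc.isCompact.exists_isGreatest hne
      have hmT := (hgs hm).2
      refine ⟨(m + T) / 2, by linarith, fun t ht => image_eq_zero_of_notMem_tsupport fun h' => ?_⟩
      have := hmax h'
      linarith
  obtain ⟨T', hT', hg'⟩ := hsupp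
  have hη0 : ∀ t, T' ≤ t → η t = 0 := by
    intro t ht
    rw [hη]
    refine (intervalIntegral.integral_congr (g := fun _ => (0 : ℝ)) fun s hs => hg' s ?_).trans
      (by simp)
    exact (le_min hT'.le ht).trans hs.1
  have h1 := h η hsmooth ⟨T', hT', hη0⟩
  rw [hder] at h1
  have hqI : IntervalIntegrable q volume 0 T := by
    rw [intervalIntegrable_iff_integrableOn_Ioo_of_le hT.le]; exact hq
  -- Integration by parts against the primitive of `q`; the boundary term at `T` drops out since `η
  -- T = 0`.
  have h2 := primitive_mul_primitive hqI (hgi 0 T) c (η 0)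
  have hηt : ∀ t, η 0 + ∫ τ in (0)..t, g τ = η t := fun t => by
    rw [hη]; exact intervalIntegral.integral_add_adjacent_intervals (hgi _ _) (hgi _ _)
  simp only [hηt, hη0 T hT'.le, mul_zero] at h2
  rw [intervalIntegral.integral_of_le hT.le, integral_Ioc_eq_integral_Ioo] at h2
  have hηc : Continuous η := hsmooth.continuous
  have i1 : IntegrableOn (fun t => q t * η t) (Ioo 0 T) := by
    have := hqI.mul_continuousOn hηc.continuousOn
    rwa [intervalIntegrable_iff_integrableOn_Ioo_of_le hT.le] at this
  have i2 : IntegrableOn (fun t => (c + ∫ τ in (0)..t, q τ) * g t) (Ioo 0 T) :=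
    ((hPc.mul hgcont.continuousOn).integrableOn_Icc).mono_set Ioo_subset_Icc_self
  have i3 : IntegrableOn (fun t => g t * p t) (Ioo 0 T) := by
    have hpI : IntervalIntegrable p volume 0 T := by
      rw [intervalIntegrable_iff_integrableOn_Ioo_of_le hT.le]; exact hp
    have := hpI.continuousOn_mul hgcont.continuousOn
    rwa [intervalIntegrable_iff_integrableOn_Ioo_of_le hT.le] at this
  rw [integral_add i1 i2] at h2
  have h3 : ∫ t, g t • (p t - (c + ∫ τ in (0)..t, q τ))
      = ∫ t in Ioo 0 T, g t • (p t - (c + ∫ τ in (0)..t, q τ)) := by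
    rw [setIntegral_eq_integral_of_forall_compl_eq_zero]
    intro t ht
    rw [hg0 t ht, zero_smul]
  have h4 : ∀ t, g t • (p t - (c + ∫ τ in (0)..t, q τ))
      = g t * p t - (c + ∫ τ in (0)..t, q τ) * g t := fun t => by rw [smul_eq_mul]; ring
  rw [h3]
  simp only [h4]
  rw [integral_sub i3 i2]
  simp only [mul_comm (η _) (q _)] at h1
  linarith

/-! ### Weakly continuous representatives in a Hilbert space. -/

/-- Banach–Alaoglu: along an ultrafilter of good times tending to `t`, the bounded values `u τ` have
a weak-* limit, which Riesz represents by a vector. Continuity of the `c i` identifies its pairings.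
This defines the representative at the exceptional times and at the endpoints. -/
lemma exists_inner_eq_of_ae_inner_eq {H : Type*} [NormedAddCommGroup H] [InnerProductSpace ℝ H]
    [CompleteSpace H] {ι : Type*} {e : ι → H} {A : Set ℝ} {u : ℝ → H} {M : ℝ}
    (hM : ∀ τ ∈ A, ‖u τ‖ ≤ M) {c : ι → ℝ → ℝ} {S : Set ℝ} (hAS : A ⊆ S)
    (hc : ∀ i, ContinuousOn (c i) S) (huc : ∀ τ ∈ A, ∀ i, ⟪u τ, e i⟫ = c i τ)
    {t : ℝ} (htS : t ∈ S) (ht : t ∈ closure A) :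
    ∃ y : H, ‖y‖ ≤ M ∧ ∀ i, ⟪y, e i⟫ = c i t := by
  have : (𝓝[A] t).NeBot := mem_closure_iff_nhdsWithin_neBot.1 ht
  let 𝒰 := Ultrafilter.of (𝓝[A] t)
  have h𝒰 : (𝒰 : Filter ℝ) ≤ 𝓝[A] t := Ultrafilter.of_le _
  let f : ℝ → WeakDual ℝ H := fun τ => StrongDual.toWeakDual (InnerProductSpace.toDual ℝ H (u τ))
  have hAmem : A ∈ (𝒰 : Filter ℝ) := h𝒰 self_mem_nhdsWithin
  obtain ⟨l, hl, hlim⟩ := (WeakDual.isCompact_closedBall (𝕜 := ℝ) (E := H) 0 M).ultrafilter_le_nhds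
    (𝒰.map f) (by
      rw [le_principal_iff]
      change f ⁻¹' _ ∈ (𝒰 : Filter ℝ)
      refine mem_of_superset hAmem fun τ hτ => ?_
      simpa [f] using hM τ hτ)
  refine ⟨(InnerProductSpace.toDual ℝ H).symm (WeakDual.toStrongDual l), ?_, fun i => ?_⟩
  · simpa using hl
  · have h1 : Tendsto (fun τ => f τ (e i)) 𝒰 (𝓝 (l (e i))) :=
      ((WeakDual.eval_continuous (e i)).tendsto l).comp hlim
    have h2 : Tendsto (fun τ => f τ (e i)) 𝒰 (𝓝 (c i t)) := by
      have h3 : Tendsto (c i) 𝒰 (𝓝 (c i t)) :=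
        (hc i t htS).mono_left (h𝒰.trans (nhdsWithin_mono _ hAS))
      refine h3.congr' ?_
      filter_upwards [hAmem] with τ hτ
      rw [← huc τ hτ i]
      simp [f]
    rw [InnerProductSpace.toDual_symm_apply]
    exact tendsto_nhds_unique h1 h2

/-- A bounded function with values in a Hilbert space whose pairings with a total countable family
have continuous representatives has a weakly continuous representative. -/
lemma exists_weaklyContinuous_rep {H : Type*} [NormedAddCommGroup H] [InnerProductSpace ℝ H]
    [CompleteSpace H] {ι : Type*} [Countable ι] {e : ι → H}
    (hspan : (Submodule.span ℝ (range e)).topologicalClosure = ⊤) {T : ℝ} (hT : 0 < T)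
    {u : ℝ → H} {M : ℝ} (hM : ∀ᵐ t ∂(volume.restrict (Ioo 0 T)), ‖u t‖ ≤ M) {c : ι → ℝ → ℝ}
    (hc : ∀ i, ContinuousOn (c i) (Icc 0 T))
    (huc : ∀ i, ∀ᵐ t ∂(volume.restrict (Ioo 0 T)), ⟪u t, e i⟫ = c i t) :
    ∃ v : ℝ → H, (∀ᵐ t ∂(volume.restrict (Ioo 0 T)), v t = u t) ∧
      ∀ w, ContinuousOn (fun t => ⟪v t, w⟫) (Icc 0 T) := by
  -- The good times have full measure in `(0,T)`, hence are dense in `[0,T]`.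
  set A : Set ℝ := {t | t ∈ Ioo 0 T ∧ ‖u t‖ ≤ M ∧ ∀ i, ⟪u t, e i⟫ = c i t} with hA
  have hAae : ∀ᵐ t ∂(volume.restrict (Ioo 0 T)), t ∈ A := by
    filter_upwards [hM, ae_all_iff.2 huc, ae_restrict_mem measurableSet_Ioo] with t h1 h2 h3
    exact ⟨h3, h1, h2⟩
  have hAS : A ⊆ Icc 0 T := fun t ht => Ioo_subset_Icc_self ht.1
  have hcl : Icc 0 T ⊆ closure A := by
    rw [← closure_Ioo hT.ne]
    refine closure_minimal (fun t ht => ?_) isClosed_closure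
    have hd : Dense {t | t ∈ Ioo 0 T → t ∈ A} :=
      Measure.dense_of_ae ((ae_restrict_iff' measurableSet_Ioo).1 hAae)
    have := hd.open_subset_closure_inter isOpen_Ioo ht
    exact closure_mono (fun s hs => hs.2 hs.1) this
  have hex : ∀ t ∈ Icc 0 T, ∃ y : H, ‖y‖ ≤ M ∧ ∀ i, ⟪y, e i⟫ = c i t := fun t ht =>
    exists_inner_eq_of_ae_inner_eq (fun τ hτ => hτ.2.1) hAS hc (fun τ hτ => hτ.2.2) ht (hcl ht)
  choose! v hv1 hv2 using hex
  refine ⟨v, ?_, fun w => ?_⟩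
  · filter_upwards [hAae] with t ht
    have h0 : v t - u t ∈ (Submodule.span ℝ (range e))ᗮ := by
      rw [Submodule.mem_orthogonal']
      intro y hy
      induction hy using Submodule.span_induction with
      | mem x hx =>
        obtain ⟨i, rfl⟩ := hx
        rw [inner_sub_left, hv2 t (hAS ht), ht.2.2, sub_self]
      | zero => simp
      | add x y _ _ hx hy => rw [inner_add_right, hx, hy, add_zero]
      | smul a x _ hx => rw [inner_smul_right, hx, mul_zero]
    rw [Submodule.topologicalClosure_eq_top_iff.1 hspan, Submodule.mem_bot] at h0
    exact sub_eq_zero.1 h0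
  · have hs : ∀ w ∈ Submodule.span ℝ (range e), ContinuousOn (fun t => ⟪v t, w⟫) (Icc 0 T) := by
      intro w hw
      induction hw using Submodule.span_induction with
      | mem x hx =>
        obtain ⟨i, rfl⟩ := hx
        exact (hc i).congr fun t ht => hv2 t ht i
      | zero => simpa using continuousOn_const
      | add x y _ _ hx hy => simpa only [inner_add_right] using ContinuousOn.fun_add hx hy
      | smul a x _ hx => simpa only [inner_smul_right] using continuousOn_const.fun_mul hx
    -- By the uniform bound on `v`, the pairing with any `w` is a uniform limit of pairings with
    -- elements of the span.
    refine continuousOn_of_uniform_approx_of_continuousOn fun V hV => ?_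
    obtain ⟨ε, hε, hεV⟩ := Metric.mem_uniformity_dist.1 hV
    have hw : w ∈ closure (Submodule.span ℝ (range e) : Set H) := by
      rw [← Submodule.topologicalClosure_coe, hspan]; trivial
    -- The bound `|M| + 1` in place of `M` keeps the denominator positive.
    obtain ⟨w', hw', hd⟩ := Metric.mem_closure_iff.1 hw (ε / (|M| + 1)) (by positivity)
    refine ⟨_, hs w' hw', fun t ht => hεV ?_⟩
    rw [Real.dist_eq, ← inner_sub_right]
    rw [dist_eq_norm, lt_div_iff₀ (by positivity)] at hd
    calc |⟪v t, w - w'⟫| ≤ ‖v t‖ * ‖w - w'‖ := abs_real_inner_le_norm _ _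
      _ ≤ |M| * ‖w - w'‖ := by gcongr; exact (hv1 t ht).trans (le_abs_self M)
      _ ≤ ‖w - w'‖ * (|M| + 1) := by nlinarith [norm_nonneg (w - w')]
      _ < ε := hd


/-! ### Coefficients of vector fields; divergence and gradient on the Fourier side. -/

lemma memLp_coord {p : ℝ≥0∞} {f : Torus d → Vec d} (hf : MemLp f p) (j : Fin d) :
    MemLp (fun x => f x j) p :=
  (EuclideanSpace.proj (𝕜 := ℝ) j).comp_memLp' hf

lemma memLp_two_coord (f : L2 d) (j : Fin d) : MemLp (fun x => f x j) 2 :=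
  memLp_coord (Lp.memLp f) j

lemma integrable_mul_of_memLp_two {f g : Torus d → ℝ} (hf : MemLp f 2) (hg : MemLp g 2) :
    Integrable fun x => f x * g x :=
  hf.integrable_mul hg

lemma integral_norm_sq_eq_sum (f : L2 d) : ∫ x, ‖f x‖ ^ 2 = ∑ j, ∫ x, f x j ^ 2 := by
  simp only [EuclideanSpace.real_norm_sq_eq]
  exact integral_finsetSum _ fun j _ => (memLp_two_coord f j).integrable_sq

lemma norm_sq_eq_integral (f : L2 d) : ‖f‖ ^ 2 = ∫ x, ‖f x‖ ^ 2 := by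
  rw [← real_inner_self_eq_norm_sq, L2.inner_def]
  simp only [real_inner_self_eq_norm_sq]

lemma hasSum_trigCoeff_norm_sq (f : L2 d) :
    HasSum (fun k => ∑ j, ∑ b, trigCoeff k b (fun x => f x j) ^ 2) (∫ x, ‖f x‖ ^ 2) := by
  rw [integral_norm_sq_eq_sum]
  exact hasSum_sum fun j _ => hasSum_trigCoeff_sq (memLp_two_coord f j)

lemma eq_zero_of_trigCoeff_eq_zero {f : L2 d} (h : ∀ k b j, trigCoeff k b (fun x => f x j) = 0) :
    f = 0 := by
  have := hasSum_trigCoeff_norm_sq f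
  simp only [h] at this
  have h0 : ∫ x, ‖f x‖ ^ 2 = 0 := this.unique (by simp)
  rw [← norm_sq_eq_integral] at h0
  simpa using h0

lemma trigCoeff_sub {f g : L2 d} (k : Fin d → ℤ) (b : Bool) (j : Fin d) :
    trigCoeff k b (fun x => (f - g : L2 d) x j)
      = trigCoeff k b (fun x => f x j) - trigCoeff k b (fun x => g x j) := by
  unfold trigCoeff
  rw [← integral_sub
    (integrable_mul_trig ((memLp_two_coord f j).integrable (by norm_num)) k b)
    (integrable_mul_trig ((memLp_two_coord g j).integrable (by norm_num)) k b)]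
  refine integral_congr_ae ?_
  filter_upwards [Lp.coeFn_sub f g] with x hx
  rw [hx, Pi.sub_apply, PiLp.sub_apply, sub_mul]

lemma eq_of_trigCoeff_eq {f g : L2 d}
    (h : ∀ k b j, trigCoeff k b (fun x => f x j) = trigCoeff k b (fun x => g x j)) : f = g := by
  rw [← sub_eq_zero]
  exact eq_zero_of_trigCoeff_eq_zero fun k b j => by rw [trigCoeff_sub, h, sub_self]

/-- The field `trig k b` times the constant vector `a`, as an element of `L²`. -/
noncomputable def trigField (k : Fin d → ℤ) (b : Bool) (a : Vec d) : L2 d :=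
  ((ContinuousLinearMap.toSpanSingleton ℝ a).comp_memLp' (memLp_trig k b 2)).toLp

lemma coeFn_trigField (k : Fin d → ℤ) (b : Bool) (a : Vec d) :
    trigField k b a =ᵐ[volume] fun x => trig k b x • a :=
  MemLp.coeFn_toLp _

lemma integral_inner_trig_smul (f : L2 d) (k : Fin d → ℤ) (b : Bool) (a : Vec d) :
    ∫ x, ⟪f x, trig k b x • a⟫ = ∑ j, a j * trigCoeff k b (fun x => f x j) := by
  have h : ∀ x, ⟪f x, trig k b x • a⟫ = ∑ j, a j * (f x j * trig k b x) := fun x => by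
    rw [PiLp.inner_apply]
    refine Finset.sum_congr rfl fun j _ => ?_
    simp
    ring
  simp only [h, trigCoeff]
  rw [integral_finsetSum]
  · simp only [integral_const_mul]
  · exact fun j _ => (integrable_mul_trig
      ((memLp_two_coord f j).integrable (by norm_num)) k b).const_mul _

lemma inner_trigField (f : L2 d) (k : Fin d → ℤ) (b : Bool) (a : Vec d) :
    ⟪f, trigField k b a⟫ = ∑ j, a j * trigCoeff k b (fun x => f x j) := by
  rw [L2.inner_def, ← integral_inner_trig_smul]
  refine integral_congr_ae ?_
  filter_upwards [coeFn_trigField k b a] with x hx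
  rw [hx]

lemma inner_trigField_single (f : L2 d) (k : Fin d → ℤ) (b : Bool) (j : Fin d) :
    ⟪f, trigField k b (EuclideanSpace.single j 1)⟫ = trigCoeff k b (fun x => f x j) := by
  rw [inner_trigField, Finset.sum_eq_single j]
  · simp
  · intro i _ hi; simp [hi]
  · simp

lemma span_trigField_closure_eq_top :
    (Submodule.span ℝ (range fun n : (Fin d → ℤ) × Bool × Fin d =>
      trigField n.1 n.2.1 (EuclideanSpace.single n.2.2 1))).topologicalClosure = ⊤ := by
  rw [Submodule.topologicalClosure_eq_top_iff, Submodule.eq_bot_iff]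
  intro f hf
  refine eq_zero_of_trigCoeff_eq_zero fun k b j => ?_
  rw [← inner_trigField_single]
  exact (Submodule.mem_orthogonal' _ _).1 hf _ (Submodule.subset_span ⟨(k, b, j), rfl⟩)

/-- The test function is `trig k (!b)`, whose gradient is a multiple of `trig k b`. -/
lemma IsDivFree.sum_freq_mul_trigCoeff {f : L2 d} (hf : IsDivFree f) (k : Fin d → ℤ) (b : Bool) :
    ∑ i, freq k b i * trigCoeff k b (fun x => f x i) = 0 := by
  have h := hf (trig k (!b)) (isSmooth_trig k _)
  simp only [partialDeriv_trig, freq_not, Bool.not_not] at h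
  rw [integral_finsetSum] at h
  · rw [← neg_eq_zero, ← Finset.sum_neg_distrib, ← h]
    refine Finset.sum_congr rfl fun i _ => ?_
    rw [trigCoeff, ← neg_mul, ← integral_const_mul]
    congr 1
    funext x
    ring
  · intro i _
    have := (integrable_mul_trig
      ((memLp_two_coord f i).integrable (by norm_num)) k b).const_mul (-freq k b i)
    refine this.congr (Eventually.of_forall fun x => ?_)
    ring

lemma IsWeakPartialDeriv.freq_mul_trigCoeff {i : Fin d} {f g : L2 d}
    (h : IsWeakPartialDeriv i f g) (k : Fin d → ℤ) (b : Bool) (j : Fin d) :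
    freq k b i * trigCoeff k b (fun x => f x j) = trigCoeff k (!b) (fun x => g x j) := by
  have h1 := h (trig k (!b)) (isSmooth_trig k _)
  have hi : ∀ (c : Bool) (f : L2 d), Integrable fun x => trig k c x • f x := fun c f =>
    ((Lp.memLp f).integrable (by norm_num)).bdd_smul 1
      (continuous_trig k c).aestronglyMeasurable
      (Eventually.of_forall fun x => abs_trig_le_one k c x)
  simp only [partialDeriv_trig, freq_not, Bool.not_not, mul_smul] at h1
  rw [integral_smul] at h1
  have h2 := congrArg (EuclideanSpace.proj (𝕜 := ℝ) j) h1
  rw [map_smul, map_neg, ← ContinuousLinearMap.integral_comp_comm _ (hi b f),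
    ← ContinuousLinearMap.integral_comp_comm _ (hi (!b) g)] at h2
  change -freq k b i * ∫ x, trig k b x * f x j = -∫ x, trig k (!b) x * g x j at h2
  simp only [trigCoeff, mul_comm _ (trig k _ _)]
  linarith


/-! ### Vanishing of the convective term. -/

lemma memLp_trigSum (F : Finset (Fin d → ℤ)) (h : Torus d → ℝ) : MemLp (trigSum F h) 2 :=
  (continuous_trigSum F h).memLp_of_hasCompactSupport (HasCompactSupport.of_compactSpace _)

lemma memLp_two_mul_sin {f : Torus d → ℝ} (hf : MemLp f 2) {h : Torus d → ℝ}
    (hh : AEStronglyMeasurable h) (M : ℝ) : MemLp (fun x => f x * Real.sin (h x / M)) 2 := by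
  have hm : AEStronglyMeasurable (fun x => Real.sin (h x / M)) volume :=
    Real.continuous_sin.comp_aestronglyMeasurable
      ((continuous_id.div_const M).comp_aestronglyMeasurable hh)
  refine hf.mono (hf.1.mul hm) (Eventually.of_forall fun x => ?_)
  rw [norm_mul]
  exact mul_le_of_le_one_right (norm_nonneg _) (Real.abs_sin_le_one _)

lemma abs_integral_mul_le {f g : Torus d → ℝ} (hf : MemLp f 2) (hg : MemLp g 2) :
    |∫ x, f x * g x| ≤ (eLpNorm f 2 volume * eLpNorm g 2 volume).toReal := by
  rw [← Real.norm_eq_abs]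
  refine (norm_integral_le_integral_norm _).trans ?_
  rw [integral_norm_eq_lintegral_enorm (integrable_mul_of_memLp_two hf hg).1,
    ← eLpNorm_one_eq_lintegral_enorm]
  refine ENNReal.toReal_mono (ENNReal.mul_ne_top hf.2.ne hg.2.ne) ?_
  have h := eLpNorm_smul_le_mul_eLpNorm (p := 2) (q := 2) (r := 1) hg.1 hf.1
  exact h

/-- With `h_F` the partial sum, the smooth function `-M cos(h_F / M)` has gradient `sin(h_F / M)
∇h_F`, so it is the right test function. The sine is a bounded truncation of `h / M`. -/
lemma IsDivFree.integral_sin_trigSum_eq_zero {f : L2 d} (hf : IsDivFree f) {h : Torus d → ℝ}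
    {g : Fin d → Torus d → ℝ}
    (hg : ∀ i k b, freq k b i * trigCoeff k b h = trigCoeff k (!b) (g i))
    (F : Finset (Fin d → ℤ)) {M : ℝ} (hM : M ≠ 0) :
    ∑ i, ∫ x, (f x i * Real.sin (trigSum F h x / M)) * trigSum F (g i) x = 0 := by
  have hs : IsSmooth (fun x => -M * Real.cos (trigSum F h x / M)) :=
    contDiff_const.mul (Real.contDiff_cos.comp ((isSmooth_trigSum F h).div_const M))
  have hp : ∀ i x, partialDeriv i (fun x => -M * Real.cos (trigSum F h x / M)) x
      = Real.sin (trigSum F h x / M) * trigSum F (g i) x := by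
    intro i x
    have h1 := (((hasDerivAt_trigSum F i (hg i) x).div_const M).cos).const_mul (-M)
    refine h1.deriv.trans ?_
    simp
    field_simp
  have := hf _ hs
  simp only [hp] at this
  rw [integral_finsetSum] at this
  · simpa only [mul_assoc] using this
  · intro i _
    simpa only [mul_assoc] using integrable_mul_of_memLp_two
      (memLp_two_mul_sin (memLp_two_coord f i) (continuous_trigSum F h).aestronglyMeasurable M)
      (memLp_trigSum F (g i))

/-- Limit of partial sums. The sine factor converges a.e. along a subsequence and is bounded by `1`,
so `|fᵢ gᵢ|` dominates; the gradient factor converges in `L²` and is handled by Cauchy–Schwarz. -/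
lemma IsDivFree.integral_sin_eq_zero {f : L2 d} (hf : IsDivFree f) {h : Torus d → ℝ}
    (hh : MemLp h 2) {g : Fin d → Torus d → ℝ} (hg2 : ∀ i, MemLp (g i) 2)
    (hg : ∀ i k b, freq k b i * trigCoeff k b h = trigCoeff k (!b) (g i))
    {M : ℝ} (hM : M ≠ 0) :
    ∑ i, ∫ x, (f x i * Real.sin (h x / M)) * g i x = 0 := by
  have hmeas : TendstoInMeasure volume (fun F => trigSum F h) atTop h :=
    tendstoInMeasure_of_tendsto_eLpNorm (p := 2) (by norm_num)
      (fun F => (memLp_trigSum F h).1) hh.1 (tendsto_eLpNorm_trigSum_sub hh)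
  obtain ⟨F, hF, hae⟩ := hmeas.exists_seq_tendsto_ae'
  have hfi := fun i => memLp_two_coord f i
  have hsF : ∀ i n, MemLp (fun x => f x i * Real.sin (trigSum (F n) h x / M)) 2 := fun i n =>
    memLp_two_mul_sin (hfi i) (continuous_trigSum _ h).aestronglyMeasurable M
  have hsub : ∀ i n, MemLp (fun x => trigSum (F n) (g i) x - g i x) 2 := fun i n =>
    (memLp_trigSum _ _).sub (hg2 i)
  have hlim : ∀ i, Tendsto (fun n => ∫ x, (f x i * Real.sin (trigSum (F n) h x / M))
      * trigSum (F n) (g i) x) atTop (𝓝 (∫ x, (f x i * Real.sin (h x / M)) * g i x)) := by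
    intro i
    have h1 : Tendsto (fun n => ∫ x, (f x i * Real.sin (trigSum (F n) h x / M)) * g i x) atTop
        (𝓝 (∫ x, (f x i * Real.sin (h x / M)) * g i x)) := by
      refine tendsto_integral_of_dominated_convergence (fun x => ‖f x i * g i x‖)
        (fun n => (integrable_mul_of_memLp_two (hsF i n) (hg2 i)).1)
        (integrable_mul_of_memLp_two (hfi i) (hg2 i)).norm ?_ ?_
      · refine fun n => Eventually.of_forall fun x => ?_
        simp only [norm_mul]
        gcongr
        exact mul_le_of_le_one_right (norm_nonneg _) (Real.abs_sin_le_one _)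
      · filter_upwards [hae] with x hx
        exact (((Real.continuous_sin.tendsto _).comp (hx.div_const M)).const_mul _).mul_const _
    have h2 : Tendsto (fun n => ∫ x, (f x i * Real.sin (trigSum (F n) h x / M))
        * (trigSum (F n) (g i) x - g i x)) atTop (𝓝 0) := by
      have h3 : Tendsto (fun n => (eLpNorm (fun x => f x i) 2 volume
          * eLpNorm (fun x => trigSum (F n) (g i) x - g i x) 2 volume).toReal) atTop (𝓝 0) := by
        have h4 := (ENNReal.Tendsto.const_mul ((tendsto_eLpNorm_trigSum_sub (hg2 i)).comp hF)
          (Or.inr (hfi i).2.ne))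
        rw [mul_zero] at h4
        exact (ENNReal.tendsto_toReal ENNReal.zero_ne_top).comp h4
      refine squeeze_zero_norm (fun n => ?_) h3
      refine (abs_integral_mul_le (hsF i n) (hsub i n)).trans ?_
      refine ENNReal.toReal_mono (ENNReal.mul_ne_top (hfi i).2.ne
        (hsub i n).2.ne) ?_
      gcongr
      refine eLpNorm_mono fun x => ?_
      rw [norm_mul]
      exact mul_le_of_le_one_right (norm_nonneg _) (Real.abs_sin_le_one _)
    have h5 := h1.add h2
    rw [add_zero] at h5
    refine h5.congr fun n => ?_
    rw [← integral_add (integrable_mul_of_memLp_two (hsF i n) (hg2 i))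
      (integrable_mul_of_memLp_two (hsF i n) (hsub i n))]
    congr 1
    funext x
    ring
  refine tendsto_nhds_unique (tendsto_finsetSum _ fun i _ => hlim i) ?_
  simp only [hf.integral_sin_trigSum_eq_zero hg _ hM]
  exact tendsto_const_nhds

lemma tendsto_mul_sin_div (y : ℝ) :
    Tendsto (fun n : ℕ => ((n : ℝ) + 1) * Real.sin (y / ((n : ℝ) + 1))) atTop (𝓝 y) := by
  have h : HasDerivAt (fun s : ℝ => Real.sin (y * s)) y 0 := by
    simpa using ((hasDerivAt_id (0 : ℝ)).const_mul y).sin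
  have h1 := h.tendsto_slope_zero
  have h2 : Tendsto (fun n : ℕ => 1 / ((n : ℝ) + 1)) atTop (𝓝[≠] 0) := by
    rw [tendsto_nhdsWithin_iff]
    exact ⟨tendsto_one_div_add_atTop_nhds_zero_nat,
      Eventually.of_forall fun n => (Nat.one_div_pos_of_nat).ne'⟩
  refine (h1.comp h2).congr fun n => ?_
  simp [div_eq_mul_inv]

/-- The convective term `∑ᵢ ∫ fᵢ h ∂ᵢh` vanishes for divergence-free `f` as soon as it is
absolutely convergent. -/
lemma IsDivFree.integral_mul_mul_eq_zero {f : L2 d} (hf : IsDivFree f) {h : Torus d → ℝ}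
    (hh : MemLp h 2) {g : Fin d → Torus d → ℝ} (hg2 : ∀ i, MemLp (g i) 2)
    (hg : ∀ i k b, freq k b i * trigCoeff k b h = trigCoeff k (!b) (g i))
    (hint : ∀ i, Integrable fun x => f x i * h x * g i x) :
    ∑ i, ∫ x, f x i * h x * g i x = 0 := by
  have hlim : ∀ i, Tendsto (fun n : ℕ => ∫ x, ((n : ℝ) + 1) *
      ((f x i * Real.sin (h x / ((n : ℝ) + 1))) * g i x)) atTop
      (𝓝 (∫ x, f x i * h x * g i x)) := by
    intro i
    -- Multiply by `M = n + 1` and let `n → ∞`. Since `|M sin(h / M)| ≤ |h|`, the triple product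
    -- assumed integrable is a dominating function.
    refine tendsto_integral_of_dominated_convergence (fun x => ‖f x i * h x * g i x‖)
      (fun n => ((integrable_mul_of_memLp_two
        (memLp_two_mul_sin (memLp_two_coord f i) hh.1 _) (hg2 i)).const_mul _).1)
      (hint i).norm ?_ ?_
    · refine fun n => Eventually.of_forall fun x => ?_
      have hn : (0 : ℝ) < n + 1 := by positivity
      have : ‖((n : ℝ) + 1) * Real.sin (h x / ((n : ℝ) + 1))‖ ≤ ‖h x‖ := by
        rw [norm_mul, Real.norm_of_nonneg hn.le, Real.norm_eq_abs, Real.norm_eq_abs]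
        calc ((n : ℝ) + 1) * |Real.sin (h x / (n + 1))| ≤ (n + 1) * |h x / (n + 1)| := by
              exact mul_le_mul_of_nonneg_left Real.abs_sin_le_abs hn.le
          _ = |h x| := by rw [abs_div, abs_of_pos hn]; field_simp
      calc _ = ‖f x i‖ * ‖((n : ℝ) + 1) * Real.sin (h x / ((n : ℝ) + 1))‖ * ‖g i x‖ := by
            rw [← norm_mul, ← norm_mul]; congr 1; ring
        _ ≤ ‖f x i‖ * ‖h x‖ * ‖g i x‖ := by gcongr
        _ = _ := by rw [← norm_mul, ← norm_mul]
    · refine Eventually.of_forall fun x => ?_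
      have := ((tendsto_mul_sin_div (h x)).const_mul (f x i)).mul_const (g i x)
      refine this.congr fun n => ?_
      ring
  refine tendsto_nhds_unique (tendsto_finsetSum _ fun i _ => hlim i) ?_
  simp only [integral_const_mul, ← Finset.mul_sum]
  have : ∀ n : ℕ, ∑ i, ∫ x, (f x i * Real.sin (h x / ((n : ℝ) + 1))) * g i x = 0 := fun n =>
    hf.integral_sin_eq_zero hh hg2 hg (by positivity)
  simp only [this, mul_zero]
  exact tendsto_const_nhds

/-! ### Space-time `L⁴` integrability and measurability in time. -/

lemma memLp_two_mul_of_memLp_four {f : L2 d} (h4 : MemLp f 4) (i j : Fin d) :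
    MemLp (fun x => f x i * f x j) 2 :=
  haveI : ENNReal.HolderTriple 4 4 2 := ⟨by
    rw [← two_mul, show (4 : ℝ≥0∞) = 2 * 2 by norm_num,
      ENNReal.mul_inv (by simp) (by simp), ← mul_assoc, ENNReal.mul_inv_cancel (by simp) (by simp),
      one_mul]⟩
  (memLp_coord h4 j).mul (memLp_coord h4 i)


/-- The coefficient is a bounded bilinear form in the coordinates of `f`. Continuity on `L²` makes
the quadratic terms measurable in time. -/
lemma continuous_trigCoeff_mul (k : Fin d → ℤ) (b : Bool) (i j : Fin d) :
    Continuous fun f : L2 d => trigCoeff k b (fun x => f x i * f x j) := by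
  let C : Fin d → L2 d →L[ℝ] Lp ℝ 2 (volume : Measure (Torus d)) := fun i =>
    (EuclideanSpace.proj (𝕜 := ℝ) i).compLpL 2 volume
  let m : Lp ℝ 2 (volume : Measure (Torus d)) →L[ℝ] Lp ℝ 2 (volume : Measure (Torus d)) :=
    (ContinuousLinearMap.mul ℝ ℝ).holderL volume ⊤ 2 2 (memLp_trig k b ⊤).toLp
  have h : ∀ f : L2 d, trigCoeff k b (fun x => f x i * f x j) = ⟪m (C i f), C j f⟫ := by
    intro f
    rw [L2.inner_def, trigCoeff]
    refine integral_congr_ae ?_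
    filter_upwards [(EuclideanSpace.proj (𝕜 := ℝ) i).coeFn_compLpL (p := 2) f,
      (EuclideanSpace.proj (𝕜 := ℝ) j).coeFn_compLpL (p := 2) f,
      (memLp_trig k b ⊤).coeFn_toLp,
      (ContinuousLinearMap.mul ℝ ℝ).coeFn_holder (r := 2) (memLp_trig k b ⊤).toLp (C i f)]
      with x h1 h2 h3 h4
    have h4' : m (C i f) x = trig k b x * f x i := by
      refine h4.trans ?_
      rw [h3]
      change _ * C i f x = _
      rw [show C i f x = f x i from h1]
    rw [h4', show C j f x = f x j from h2]
    simp
    ring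
  simp only [h]
  fun_prop

/-- Fatou along an a.e. convergent subsequence. It yields measurability of `t ↦ ‖u(t)‖_{L⁴}`. -/
lemma lowerSemicontinuous_eLpNorm (p : ℝ≥0∞) :
    LowerSemicontinuous fun f : L2 d => eLpNorm f p (volume : Measure (Torus d)) := by
  rw [lowerSemicontinuous_iff_isClosed_preimage]
  refine fun y => IsSeqClosed.isClosed fun F f hF hlim => ?_
  have h1 : TendstoInMeasure volume (fun n => (F n : Torus d → Vec d)) atTop f :=
    tendstoInMeasure_of_tendsto_Lp hlim
  obtain ⟨n, -, hn⟩ := h1.exists_seq_tendsto_ae'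
  exact Lp.eLpNorm_le_of_ae_tendsto (u := atTop) (Eventually.of_forall fun m => hF (n m))
    (fun m => (Lp.memLp (F (n m))).1) hn

lemma lintegral_enorm_pow_four (f : Torus d → Vec d) :
    ∫⁻ x, ‖f x‖ₑ ^ 4 = eLpNorm f 4 volume ^ 4 := by
  have h := eLpNorm_nnreal_pow_eq_lintegral (f := f) (p := 4) (μ := volume) (by norm_num)
  simpa using h.symm

/-- Interpolation of `L⁴` between `L²` and `Lˢ`; the exponent `ρ` satisfies `1/ρ + 1/s = 1/2`. -/
lemma exists_lintegral_pow_four_le {s : ℝ≥0∞} (hs : 4 ≤ s) :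
    ∃ ρ : ℝ, 0 < ρ ∧ (∀ r : ℝ≥0∞, 1 / r + 1 / s ≤ 1 / 2 → ENNReal.ofReal ρ ≤ r) ∧
      ∀ M : ℝ≥0∞, M ≠ ⊤ → ∃ C : ℝ≥0∞, C ≠ ⊤ ∧ ∀ f : Torus d → Vec d, AEStronglyMeasurable f →
        eLpNorm f 2 volume ≤ M → ∫⁻ x, ‖f x‖ₑ ^ 4 ≤ C * eLpNorm f s volume ^ ρ := by
  have two : ∀ f : Torus d → Vec d, ∫⁻ x, ‖f x‖ₑ ^ (2 : ℝ) = eLpNorm f 2 volume ^ (2 : ℝ) := by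
    intro f
    have h := eLpNorm_nnreal_pow_eq_lintegral (f := f) (p := 2) (μ := volume) (by norm_num)
    simpa using h.symm
  rcases eq_or_ne s ⊤ with rfl | hs'
  · refine ⟨2, by norm_num, fun r hr => ?_, fun M hM => ⟨M ^ (2 : ℝ), by simp [hM], ?_⟩⟩
    · simp only [one_div, ENNReal.inv_top, add_zero, ENNReal.inv_le_inv] at hr
      simpa using hr
    · intro f hf hfM
      calc ∫⁻ x, ‖f x‖ₑ ^ 4 ≤ ∫⁻ x, ‖f x‖ₑ ^ (2 : ℝ) * eLpNorm f ⊤ volume ^ (2 : ℝ) := by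
            refine lintegral_mono_ae ?_
            filter_upwards [ae_le_eLpNormEssSup (f := f) (μ := volume)] with x hx
            rw [eLpNorm_exponent_top, show (4 : ℕ) = 2 + 2 by norm_num, pow_add]
            simp only [ENNReal.rpow_two]
            gcongr
        _ = eLpNorm f 2 volume ^ (2 : ℝ) * eLpNorm f ⊤ volume ^ (2 : ℝ) := by
            rw [lintegral_mul_const'' _ (hf.enorm.pow_const _), two]
        _ ≤ _ := by gcongr
  · lift s to NNReal using hs'
    have hs4 : (4 : ℝ) ≤ s := by exact_mod_cast hs
    have hs2 : (0 : ℝ) < s - 2 := by linarith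
    -- The Hölder weight solving `4 = 2(1 - l) + s l`; `l ≤ 1` is exactly `s ≥ 4`. Then `ρ = s l =
    -- 2s/(s - 2)`.
    set l : ℝ := 2 / (s - 2) with hl
    have hl0 : 0 < l := by positivity
    have hl1 : l ≤ 1 := by rw [hl, div_le_one hs2]; linarith
    refine ⟨s * l, by positivity, fun r hr => ?_, fun M hM =>
      ⟨(M ^ (2 : ℝ)) ^ (1 - l), ENNReal.rpow_ne_top_of_nonneg (by linarith) (by simp [hM]), ?_⟩⟩
    · rcases eq_or_ne r ⊤ with rfl | hr'
      · exact le_top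
      lift r to NNReal using hr'
      have hr0 : r ≠ 0 := by
        rintro rfl
        simp at hr
      have hs0 : s ≠ 0 := by rintro rfl; norm_num at hs4
      have hr2 : (1 : ℝ) / r + 1 / s ≤ 1 / 2 := by
        have h' : ((1 / r + 1 / s : NNReal) : ℝ≥0∞) ≤ ((1 / 2 : NNReal) : ℝ≥0∞) := by
          rw [ENNReal.coe_add, ENNReal.coe_div hr0, ENNReal.coe_div hs0,
            ENNReal.coe_div two_ne_zero]
          simpa using hr
        have h'' := NNReal.coe_le_coe.2 (ENNReal.coe_le_coe.1 h')
        simpa using h''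
      rw [ENNReal.ofReal_le_iff_le_toReal (by simp), ENNReal.coe_toReal]
      have hrp : (0 : ℝ) < r := by positivity
      have hsp : (0 : ℝ) < s := by positivity
      rw [div_add_div _ _ hrp.ne' hsp.ne', div_le_div_iff₀ (by positivity) (by norm_num)] at hr2
      rw [hl, mul_div_assoc', div_le_iff₀ hs2]
      nlinarith
    · intro f hf hfM
      have hsum : 4 = 2 * (1 - l) + s * l := by
        rw [hl]; field_simp; ring
      have e : ∀ x, ‖f x‖ₑ ^ 4 = (‖f x‖ₑ ^ (2 : ℝ)) ^ (1 - l) * (‖f x‖ₑ ^ (s : ℝ)) ^ l := by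
        intro x
        rw [← ENNReal.rpow_mul, ← ENNReal.rpow_mul,
          ← ENNReal.rpow_add_of_nonneg _ _ (by nlinarith) (by positivity), ← hsum]
        norm_cast
      simp only [e]
      refine (ENNReal.lintegral_mul_norm_pow_le (hf.enorm.pow_const _) (hf.enorm.pow_const _)
        (by linarith) hl0.le (by ring)).trans ?_
      have hs0 : s ≠ 0 := by rintro rfl; norm_num at hs4
      rw [two, ← eLpNorm_nnreal_pow_eq_lintegral hs0, ← ENNReal.rpow_mul (eLpNorm f s volume)]
      gcongr

/-- For finite `r` the pointwise bound `g^ρ ≤ 1 + g^r` suffices on a finite measure space, with no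
measurability of `g`. -/
lemma lintegral_rpow_lt_top_of_eLpNorm_lt_top {α : Type*} [MeasurableSpace α] {ν : Measure α}
    [IsFiniteMeasure ν] {g : α → ℝ≥0∞} {r : ℝ≥0∞} (hg : eLpNorm g r ν < ⊤) {ρ : ℝ} (hρ : 0 < ρ)
    (hr : ENNReal.ofReal ρ ≤ r) : ∫⁻ t, g t ^ ρ ∂ν < ⊤ := by
  rcases eq_or_ne r ⊤ with rfl | hr'
  · rw [eLpNorm_exponent_top] at hg
    calc ∫⁻ t, g t ^ ρ ∂ν ≤ ∫⁻ _, eLpNormEssSup g ν ^ ρ ∂ν := by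
          refine lintegral_mono_ae ?_
          filter_upwards [ae_le_eLpNormEssSup (f := g) (μ := ν)] with t ht
          gcongr
          simpa using ht
      _ < ⊤ := by
          rw [lintegral_const]
          exact ENNReal.mul_lt_top (ENNReal.rpow_lt_top_of_nonneg hρ.le hg.ne)
            (measure_lt_top _ _)
  · have h0 : r ≠ 0 := by
      rintro rfl
      simp at hr
      linarith
    have hρr : ρ ≤ r.toReal := (ENNReal.ofReal_le_iff_le_toReal hr').1 hr
    have h1 : ∫⁻ t, g t ^ r.toReal ∂ν < ⊤ := by
      simpa using (eLpNorm_lt_top_iff_lintegral_rpow_enorm_lt_top h0 hr').1 hg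
    calc ∫⁻ t, g t ^ ρ ∂ν ≤ ∫⁻ t, (1 + g t ^ r.toReal) ∂ν := by
          refine lintegral_mono fun t => ?_
          rcases le_total (g t) 1 with h | h
          · exact (ENNReal.rpow_le_one h hρ.le).trans le_self_add
          · exact (ENNReal.rpow_le_rpow_of_exponent_le h hρr).trans le_add_self
      _ < ⊤ := by
          rw [lintegral_add_left measurable_const]
          exact ENNReal.add_lt_top.2 ⟨by simp [measure_lt_top], h1⟩

/-- The mixed-norm condition enters the whole argument only through this bound. -/
lemma lintegral_lintegral_pow_four_lt_top {T : ℝ} {u : ℝ → L2 d} (hu : MemLinftyL2 T u)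
    {r s : ℝ≥0∞} (hrs : 1 / r + 1 / s ≤ 1 / 2) (hs : 4 ≤ s) (h : MemLrLs T r s u) :
    ∫⁻ t in Ioo 0 T, ∫⁻ x, ‖u t x‖ₑ ^ 4 < ⊤ := by
  obtain ⟨ρ, hρ, hρr, hC⟩ := exists_lintegral_pow_four_le (d := d) hs
  obtain ⟨C, hCt, hC⟩ := hC (eLpNorm u ⊤ (volume.restrict (Ioo 0 T))) hu.2.ne
  have h1 : ∀ᵐ t ∂(volume.restrict (Ioo 0 T)),
      ∫⁻ x, ‖u t x‖ₑ ^ 4 ≤ C * eLpNorm (u t) s volume ^ ρ := by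
    have h2 := ae_le_eLpNormEssSup (f := u) (μ := volume.restrict (Ioo 0 T))
    filter_upwards [h2] with t ht
    refine hC _ (Lp.memLp (u t)).1 ?_
    rw [eLpNorm_exponent_top]
    rwa [Lp.enorm_def] at ht
  refine (lintegral_mono_ae h1).trans_lt ?_
  rw [lintegral_const_mul' _ _ hCt]
  exact ENNReal.mul_lt_top hCt.lt_top
    (lintegral_rpow_lt_top_of_eLpNorm_lt_top h hρ (hρr r hrs))

lemma aemeasurable_lintegral_pow_four {T : ℝ} {u : ℝ → L2 d} (hu : MemLinftyL2 T u) :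
    AEMeasurable (fun t => ∫⁻ x, ‖u t x‖ₑ ^ 4) (volume.restrict (Ioo 0 T)) := by
  borelize (L2 d)
  simp only [lintegral_enorm_pow_four]
  exact ((lowerSemicontinuous_eLpNorm 4).measurable.comp_aemeasurable
    hu.1.aemeasurable).pow_const 4

lemma ae_memLp_four {T : ℝ} {u : ℝ → L2 d} (hu : MemLinftyL2 T u)
    (h : ∫⁻ t in Ioo 0 T, ∫⁻ x, ‖u t x‖ₑ ^ 4 < ⊤) :
    ∀ᵐ t ∂(volume.restrict (Ioo 0 T)), MemLp (u t) 4 := by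
  filter_upwards [ae_lt_top' (aemeasurable_lintegral_pow_four hu) h.ne] with t ht
  rw [lintegral_enorm_pow_four] at ht
  exact ⟨(Lp.memLp (u t)).1, (ENNReal.pow_lt_top_iff.1 ht).resolve_right (by norm_num)⟩

lemma integral_mul_sq_le {f : L2 d} (hf : MemLp f 4) (i j : Fin d) :
    ∫ x, (f x i * f x j) ^ 2 ≤ (∫⁻ x, ‖f x‖ₑ ^ 4).toReal := by
  have hne : ∫⁻ x, ‖f x‖ₑ ^ 4 ≠ ⊤ := by
    rw [lintegral_enorm_pow_four]; exact ENNReal.pow_ne_top hf.2.ne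
  rw [integral_eq_lintegral_of_nonneg_ae (Eventually.of_forall fun x => sq_nonneg _)
    ((memLp_two_mul_of_memLp_four hf i j).1.pow 2)]
  refine ENNReal.toReal_mono hne (lintegral_mono fun x => ?_)
  rw [← ofReal_norm, ← ENNReal.ofReal_pow (norm_nonneg _)]
  refine ENNReal.ofReal_le_ofReal ?_
  have h1 := PiLp.norm_apply_le (f x) i
  have h2 := PiLp.norm_apply_le (f x) j
  rw [mul_pow, ← sq_abs (f x i), ← sq_abs (f x j), ← Real.norm_eq_abs, ← Real.norm_eq_abs]
  calc ‖f x i‖ ^ 2 * ‖f x j‖ ^ 2 ≤ ‖f x‖ ^ 2 * ‖f x‖ ^ 2 := by gcongr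
    _ = ‖f x‖ ^ 4 := by ring


/-! ### Testing the equation with single modes. -/

lemma hasDerivAt_trig_smul (η : ℝ) (k : Fin d → ℤ) (b : Bool) (a : Vec d) (i : Fin d)
    (x : Torus d) :
    HasDerivAt (fun h : ℝ => η • trig k b (x + Pi.single i (h : UnitAddCircle)) • a)
      (η • (freq k b i * trig k (!b) x) • a) 0 :=
  ((hasDerivAt_trig k b i x).smul_const a).const_smul η

lemma partialDeriv_trig_smul (η : ℝ) (k : Fin d → ℤ) (b : Bool) (a : Vec d) (i : Fin d)
    (x : Torus d) :
    partialDeriv i (fun x => η • trig k b x • a) x = η • (freq k b i * trig k (!b) x) • a :=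
  (hasDerivAt_trig_smul η k b a i x).deriv

lemma isTestField_smul_trig_smul {T : ℝ} {η : ℝ → ℝ} (hη : ContDiff ℝ ∞ η)
    (hs : ∃ T' < T, ∀ t, T' ≤ t → η t = 0) {k : Fin d → ℤ} {b : Bool} {a : Vec d}
    (ha : ∑ i, a i * freq k b i = 0) :
    IsTestField T (fun t x => η t • trig k b x • a) where
  smooth := (hη.comp contDiff_fst).smul
    ((ContDiff.comp (isSmooth_trig k b) contDiff_snd).smul contDiff_const)
  support := by
    obtain ⟨T', hT', h⟩ := hs
    exact ⟨T', hT', fun t ht x => by rw [h t ht, zero_smul]⟩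
  divFree := fun t x => by
    have h : ∀ i, partialDeriv i (fun z => (η t • trig k b z • a) i) x
        = (η t * trig k (!b) x) * (a i * freq k b i) := by
      intro i
      have := (EuclideanSpace.proj (𝕜 := ℝ) i).hasFDerivAt.comp_hasDerivAt (0 : ℝ)
        (hasDerivAt_trig_smul (η t) k b a i x)
      refine this.deriv.trans ?_
      change η t * ((freq k b i * trig k (!b) x) * a i) = _
      ring
    simp only [h, ← Finset.mul_sum, ha, mul_zero]

/-- The coefficients of `-div (f ⊗ f) + μ Δ f`, where `g i = ∂_i f`. -/
noncomputable def forceCoeff (μ : ℝ) (f : L2 d) (g : Fin d → L2 d) (k : Fin d → ℤ) (b : Bool)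
    (j : Fin d) : ℝ :=
  ∑ i, freq k b i * (trigCoeff k (!b) (fun x => f x i * f x j)
    - μ * trigCoeff k (!b) (fun x => g i x j))

lemma integrable_mul_coord (f : L2 d) (i j : Fin d) : Integrable fun x => f x i * f x j :=
  integrable_mul_of_memLp_two (memLp_two_coord f i) (memLp_two_coord f j)

lemma integral_convection_trig (f : L2 d) (η : ℝ) (k : Fin d → ℤ) (b : Bool) (a : Vec d) :
    ∫ x, ∑ i, ∑ j, f x i * f x j * partialDeriv i (fun x => η • trig k b x • a) x j
      = η * ∑ j, a j * ∑ i, freq k b i * trigCoeff k (!b) (fun x => f x i * f x j) := by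
  have h : ∀ x, ∑ i, ∑ j, f x i * f x j * partialDeriv i (fun x => η • trig k b x • a) x j
      = ∑ i, ∑ j, η * (a j * (freq k b i * (f x i * f x j * trig k (!b) x))) := by
    intro x
    refine Finset.sum_congr rfl fun i _ => Finset.sum_congr rfl fun j _ => ?_
    rw [partialDeriv_trig_smul]
    simp only [PiLp.smul_apply, smul_eq_mul]
    ring
  have hi : ∀ i j, Integrable fun x =>
      η * (a j * (freq k b i * (f x i * f x j * trig k (!b) x))) := fun i j =>
    (((integrable_mul_trig (integrable_mul_coord f i j) k (!b)).const_mul _).const_mul _).const_mul _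
  simp only [h]
  rw [integral_finsetSum _ fun i _ => integrable_finsetSum _ fun j _ => hi i j, Finset.mul_sum]
  simp only [integral_finsetSum _ fun j _ => hi _ j, integral_const_mul, Finset.mul_sum]
  rw [Finset.sum_comm]
  rfl

lemma integral_diffusion_trig (g : Fin d → L2 d) (η : ℝ) (k : Fin d → ℤ) (b : Bool) (a : Vec d) :
    ∫ x, ∑ i, ⟪g i x, partialDeriv i (fun x => η • trig k b x • a) x⟫
      = η * ∑ j, a j * ∑ i, freq k b i * trigCoeff k (!b) (fun x => g i x j) := by
  have h : ∀ x, ∑ i, ⟪g i x, partialDeriv i (fun x => η • trig k b x • a) x⟫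
      = ∑ i, ∑ j, η * (a j * (freq k b i * (g i x j * trig k (!b) x))) := by
    intro x
    refine Finset.sum_congr rfl fun i _ => ?_
    rw [partialDeriv_trig_smul, PiLp.inner_apply]
    refine Finset.sum_congr rfl fun j _ => ?_
    simp
    ring
  have hi : ∀ i j, Integrable fun x =>
      η * (a j * (freq k b i * (g i x j * trig k (!b) x))) := fun i j =>
    (((integrable_mul_trig ((memLp_two_coord (g i) j).integrable (by norm_num)) k
      (!b)).const_mul _).const_mul _).const_mul _
  simp only [h]
  rw [integral_finsetSum _ fun i _ => integrable_finsetSum _ fun j _ => hi i j, Finset.mul_sum]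
  simp only [integral_finsetSum _ fun j _ => hi _ j, integral_const_mul, Finset.mul_sum]
  rw [Finset.sum_comm]
  rfl

lemma abs_trigCoeff_mul_le (f : L2 d) (k : Fin d → ℤ) (b : Bool) (i j : Fin d) :
    |trigCoeff k b (fun x => f x i * f x j)| ≤ ‖f‖ ^ 2 := by
  rw [norm_sq_eq_integral, trigCoeff]
  refine (norm_integral_le_integral_norm _).trans (integral_mono
    (integrable_mul_trig (integrable_mul_coord f i j) k b).norm (Lp.memLp f).norm.integrable_sq
    fun x => ?_)
  simp only [norm_mul]
  calc ‖f x i‖ * ‖f x j‖ * ‖trig k b x‖ ≤ ‖f x‖ * ‖f x‖ * 1 := by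
        gcongr
        · exact PiLp.norm_apply_le (f x) i
        · exact PiLp.norm_apply_le (f x) j
        · exact abs_trig_le_one k b x
    _ = ‖f x‖ ^ 2 := by ring

lemma MemLinftyL2.exists_bound {T : ℝ} {u : ℝ → L2 d} (hu : MemLinftyL2 T u) :
    ∃ M : ℝ, ∀ᵐ t ∂(volume.restrict (Ioo 0 T)), ‖u t‖ ≤ M := by
  refine ⟨(eLpNormEssSup u (volume.restrict (Ioo 0 T))).toReal, ?_⟩
  have hne := hu.2.ne
  rw [eLpNorm_exponent_top] at hne
  filter_upwards [ae_le_eLpNormEssSup (f := u) (μ := volume.restrict (Ioo 0 T))] with t ht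
  have := ENNReal.toReal_mono hne ht
  rwa [toReal_enorm] at this

lemma MemLinftyL2.integrableOn_trigCoeff_mul {T : ℝ} {u : ℝ → L2 d} (hu : MemLinftyL2 T u)
    (k : Fin d → ℤ) (b : Bool) (i j : Fin d) :
    IntegrableOn (fun t => trigCoeff k b (fun x => u t x i * u t x j)) (Ioo 0 T) := by
  obtain ⟨M, hM⟩ := hu.exists_bound
  refine Integrable.of_bound
    ((continuous_trigCoeff_mul k b i j).comp_aestronglyMeasurable hu.1) (M ^ 2) ?_
  filter_upwards [hM] with t ht
  exact (abs_trigCoeff_mul_le (u t) k b i j).trans (by gcongr)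

lemma integrableOn_trigCoeff {T : ℝ} {w : ℝ → L2 d} {p : ℝ≥0∞} (hp : 1 ≤ p)
    (hw : MemLp w p (volume.restrict (Ioo 0 T))) (k : Fin d → ℤ) (b : Bool) (j : Fin d) :
    IntegrableOn (fun t => trigCoeff k b (fun x => w t x j)) (Ioo 0 T) := by
  simp only [← inner_trigField_single]
  exact (hw.integrable hp).inner_const _

variable {μ T : ℝ} {u₀ : L2 d} {u : ℝ → L2 d} {G : ℝ → Fin d → L2 d}

lemma IsWeakSolution.integrableOn_forceCoeff (hu : IsWeakSolution μ T u₀ u G)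
    (k : Fin d → ℤ) (b : Bool) (j : Fin d) :
    IntegrableOn (fun t => forceCoeff μ (u t) (G t) k b j) (Ioo 0 T) := by
  unfold forceCoeff
  exact integrable_finsetSum _ fun i _ =>
    ((hu.memLinftyL2.integrableOn_trigCoeff_mul k (!b) i j).sub
      ((integrableOn_trigCoeff one_le_two (hu.memL2H1.grad_memLp i) k (!b) j).const_mul μ)).const_mul _

/-- Separated test fields turn the weak formulation into a scalar equation in time; `ha` makes the
field divergence-free, so no pressure appears. -/
lemma IsWeakSolution.ae_sum_mul_trigCoeff_eq (hu : IsWeakSolution μ T u₀ u G) (hT : 0 < T)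
    {k : Fin d → ℤ} {b : Bool} {a : Vec d} (ha : ∑ i, a i * freq k b i = 0) :
    ∀ᵐ t ∂(volume.restrict (Ioo 0 T)),
      ∑ j, a j * trigCoeff k b (fun x => u t x j) = ∑ j, a j * trigCoeff k b (fun x => u₀ x j)
        + ∫ τ in (0)..t, ∑ j, a j * forceCoeff μ (u τ) (G τ) k b j := by
  refine ae_eq_primitive_of_weak_form hT
    (integrable_finsetSum _ fun j _ =>
      (integrableOn_trigCoeff le_top hu.memLinftyL2 k b j).const_mul _)
    (integrable_finsetSum _ fun j _ => (hu.integrableOn_forceCoeff k b j).const_mul _)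
    fun η hη hs => ?_
  have key := hu.weak_form _ (isTestField_smul_trig_smul hη hs ha)
  have hder : ∀ t x, deriv (fun τ => η τ • trig k b x • a) t = deriv η t • trig k b x • a :=
    fun t x => deriv_smul_const (hη.differentiable (by simp) t) _
  simp only [hder, integral_convection_trig, integral_diffusion_trig, inner_smul_right _ (_ • a),
    integral_const_mul, integral_inner_trig_smul] at key
  have hηc : Continuous η := hη.continuous
  have hηi : ∀ {q : ℝ → ℝ}, IntegrableOn q (Ioo 0 T) → IntegrableOn (fun t => η t * q t) (Ioo 0 T) := by
    intro q hq
    rw [← intervalIntegrable_iff_integrableOn_Ioo_of_le hT.le] at hq ⊢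
    exact hq.continuousOn_mul hηc.continuousOn
  have i1 : IntegrableOn (fun t => η t * ∑ j, a j * ∑ i, freq k b i
      * trigCoeff k (!b) (fun x => u t x i * u t x j)) (Ioo 0 T) :=
    hηi (integrable_finsetSum _ fun j _ => (integrable_finsetSum _ fun i _ =>
      (hu.memLinftyL2.integrableOn_trigCoeff_mul k (!b) i j).const_mul _).const_mul _)
  have i2 : IntegrableOn (fun t => η t * ∑ j, a j * ∑ i, freq k b i
      * trigCoeff k (!b) (fun x => G t i x j)) (Ioo 0 T) :=
    hηi (integrable_finsetSum _ fun j _ => (integrable_finsetSum _ fun i _ =>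
      (integrableOn_trigCoeff one_le_two (hu.memL2H1.grad_memLp i) k (!b) j).const_mul _).const_mul _)
  have e : ∀ t, η t * ∑ j, a j * forceCoeff μ (u t) (G t) k b j
      = η t * (∑ j, a j * ∑ i, freq k b i * trigCoeff k (!b) (fun x => u t x i * u t x j))
        - μ * (η t * ∑ j, a j * ∑ i, freq k b i * trigCoeff k (!b) (fun x => G t i x j)) := by
    intro t
    simp only [forceCoeff, mul_sub, Finset.sum_sub_distrib, Finset.mul_sum]
    congr 1
    refine Finset.sum_congr rfl fun j _ => Finset.sum_congr rfl fun i _ => ?_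
    ring
  simp only [e]
  rw [integral_sub i1 (i2.const_mul μ), integral_const_mul]
  linarith

/-- The coefficients of the Leray projection of `-div (f ⊗ f) + μ Δ f`. -/
noncomputable def projForceCoeff (μ : ℝ) (f : L2 d) (g : Fin d → L2 d) (k : Fin d → ℤ) (b : Bool)
    (j : Fin d) : ℝ :=
  forceCoeff μ f g k b j
    -- At `k = 0` the quotient is `0 / 0 = 0`, and the projection is the identity, as it should be.
    - freq k b j / (∑ i, freq k b i ^ 2) * ∑ i, freq k b i * forceCoeff μ f g k b i

lemma IsWeakSolution.integrableOn_projForceCoeff (hu : IsWeakSolution μ T u₀ u G)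
    (k : Fin d → ℤ) (b : Bool) (j : Fin d) :
    IntegrableOn (fun t => projForceCoeff μ (u t) (G t) k b j) (Ioo 0 T) :=
  (hu.integrableOn_forceCoeff k b j).sub ((integrable_finsetSum _ fun i _ =>
    (hu.integrableOn_forceCoeff k b i).const_mul _).const_mul _)

/-- The evolution of the coefficients of `u` given by the equation. -/
noncomputable def evolvedCoeff (μ : ℝ) (u₀ : L2 d) (u : ℝ → L2 d) (G : ℝ → Fin d → L2 d)
    (k : Fin d → ℤ) (b : Bool) (j : Fin d) (t : ℝ) : ℝ :=
  trigCoeff k b (fun x => u₀ x j) + ∫ τ in (0)..t, projForceCoeff μ (u τ) (G τ) k b j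

lemma IsWeakSolution.ae_trigCoeff_eq (hu : IsWeakSolution μ T u₀ u G) (hT : 0 < T)
    (k : Fin d → ℤ) (b : Bool) (j : Fin d) :
    ∀ᵐ t ∂(volume.restrict (Ioo 0 T)),
      trigCoeff k b (fun x => u t x j) = evolvedCoeff μ u₀ u G k b j t := by
  set S := ∑ i, freq k b i ^ 2 with hS
  -- The projection of the `j`-th basis vector orthogonally to the frequency. Pairing with it
  -- returns the `j`-th coefficient of a divergence-free field unchanged, and projects the force.
  let a : Vec d := WithLp.toLp 2 fun i => (if i = j then 1 else 0) - freq k b j / S * freq k b i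
  have hsum : ∀ V : Fin d → ℝ, ∑ i, a i * V i
      = V j - freq k b j / S * ∑ i, freq k b i * V i := by
    intro V
    simp [a, sub_mul, Finset.sum_sub_distrib, Finset.mul_sum, mul_assoc]
  have ha : ∑ i, a i * freq k b i = 0 := by
    rw [hsum]
    simp only [← sq, ← hS]
    rcases eq_or_ne S 0 with h0 | h0
    · have := (Finset.sum_eq_zero_iff_of_nonneg fun i _ => sq_nonneg (freq k b i)).1 h0 j
        (Finset.mem_univ j)
      rw [pow_eq_zero_iff two_ne_zero] at this
      simp [this]
    · rw [div_mul_cancel₀ _ h0, sub_self]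
  filter_upwards [hu.ae_sum_mul_trigCoeff_eq hT ha, hu.divFree] with t ht hdiv
  simp only [hsum, hdiv.sum_freq_mul_trigCoeff, hu.initial_divFree.sum_freq_mul_trigCoeff,
    mul_zero, sub_zero] at ht
  exact ht

lemma IsWeakSolution.continuousOn_evolvedCoeff (hu : IsWeakSolution μ T u₀ u G) (hT : 0 < T)
    (k : Fin d → ℤ) (b : Bool) (j : Fin d) :
    ContinuousOn (evolvedCoeff μ u₀ u G k b j) (Icc 0 T) :=
  continuousOn_primitive_add hT.le (hu.integrableOn_projForceCoeff k b j) _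

lemma IsWeakSolution.exists_isWeaklyContinuousRep (hu : IsWeakSolution μ T u₀ u G) (hT : 0 < T) :
    ∃ v : ℝ → L2 d, IsWeaklyContinuousRep T u v := by
  obtain ⟨M, hM⟩ := hu.memLinftyL2.exists_bound
  obtain ⟨v, hv, hc⟩ := exists_weaklyContinuous_rep span_trigField_closure_eq_top hT hM
    (c := fun n => evolvedCoeff μ u₀ u G n.1 n.2.1 n.2.2)
    (fun n => hu.continuousOn_evolvedCoeff hT n.1 n.2.1 n.2.2)
    (fun n => by
      simp only [inner_trigField_single]
      exact hu.ae_trigCoeff_eq hT n.1 n.2.1 n.2.2)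
  exact ⟨v, hv, hc⟩

/-- Both sides are continuous on `[0,T]`, so a.e. equality becomes equality at every time, endpoints
included. -/
lemma IsWeakSolution.trigCoeff_rep_eq (hu : IsWeakSolution μ T u₀ u G) (hT : 0 < T)
    {v : ℝ → L2 d} (hv : IsWeaklyContinuousRep T u v) (k : Fin d → ℤ) (b : Bool) (j : Fin d)
    {t : ℝ} (ht : t ∈ Icc 0 T) :
    trigCoeff k b (fun x => v t x j) = evolvedCoeff μ u₀ u G k b j t := by
  refine Measure.eqOn_Icc_of_ae_eq volume hT.ne
    (f := fun t => trigCoeff k b (fun x => v t x j)) ?_ ?_ (hu.continuousOn_evolvedCoeff hT k b j) ht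
  · rw [← restrict_Ioo_eq_restrict_Icc]
    filter_upwards [hv.ae_eq, hu.ae_trigCoeff_eq hT k b j] with t h1 h2
    rw [h1, h2]
  · simp only [← inner_trigField_single]
    exact hv.weak_continuous _


/-! ### Energy balance per frequency and summation. -/

/-- The contribution of the frequency `k` to `∑ᵢⱼ ∫ gᵢⱼ (fᵢ fⱼ - μ gᵢⱼ)`. -/
noncomputable def energyRate (μ : ℝ) (f : L2 d) (g : Fin d → L2 d) (k : Fin d → ℤ) : ℝ :=
  ∑ i, ∑ j, ∑ b, trigCoeff k b (fun x => g i x j) *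
    (trigCoeff k b (fun x => f x i * f x j) - μ * trigCoeff k b (fun x => g i x j))

/-- The gradient part of the force is orthogonal to the divergence-free `f`, so the projection
disappears. The factor `freq k b i` is then moved onto `f`, where it produces the coefficient of
`∂ᵢf`. -/
lemma sum_projForceCoeff_mul_trigCoeff {f : L2 d} (hf : IsDivFree f) {g : Fin d → L2 d}
    (hg : ∀ i, IsWeakPartialDeriv i f (g i)) (k : Fin d → ℤ) :
    ∑ j, ∑ b, projForceCoeff μ f g k b j * trigCoeff k b (fun x => f x j)
      = energyRate μ f g k := by
  have h1 : ∀ b, ∑ j, projForceCoeff μ f g k b j * trigCoeff k b (fun x => f x j)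
      = ∑ j, ∑ i, trigCoeff k (!b) (fun x => g i x j) *
        (trigCoeff k (!b) (fun x => f x i * f x j) - μ * trigCoeff k (!b) (fun x => g i x j)) := by
    intro b
    have h2 : ∑ j, projForceCoeff μ f g k b j * trigCoeff k b (fun x => f x j)
        = ∑ j, forceCoeff μ f g k b j * trigCoeff k b (fun x => f x j)
          - (∑ i, freq k b i * forceCoeff μ f g k b i) / (∑ i, freq k b i ^ 2)
            * ∑ j, freq k b j * trigCoeff k b (fun x => f x j) := by
      rw [Finset.mul_sum, ← Finset.sum_sub_distrib]
      refine Finset.sum_congr rfl fun j _ => ?_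
      rw [projForceCoeff]
      ring
    rw [h2, hf.sum_freq_mul_trigCoeff, mul_zero, sub_zero]
    refine Finset.sum_congr rfl fun j _ => ?_
    rw [forceCoeff, Finset.sum_mul]
    refine Finset.sum_congr rfl fun i _ => ?_
    rw [← (hg i).freq_mul_trigCoeff k b j]
    ring
  rw [Finset.sum_comm]
  simp only [h1, energyRate, Fintype.sum_bool, Bool.not_true, Bool.not_false,
    Finset.sum_add_distrib]
  rw [add_comm]
  congr 1 <;> exact Finset.sum_comm

/-- Parseval applies because `f ∈ L⁴` makes `fᵢfⱼ` square integrable. For each `j` the sum over `i`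
of the cubic integrals is zero, leaving only dissipation. -/
lemma hasSum_energyRate {f : L2 d} (hf : IsDivFree f) (h4 : MemLp f 4) {g : Fin d → L2 d}
    (hg : ∀ i, IsWeakPartialDeriv i f (g i)) :
    HasSum (energyRate μ f g) (-μ * ∑ i, ‖g i‖ ^ 2) := by
  have hA := fun i j => memLp_two_mul_of_memLp_four h4 i j
  have hB := fun i j => memLp_two_coord (g i) j
  have h0 : ∀ j, ∑ i, ∫ x, f x i * f x j * g i x j = 0 := fun j =>
    hf.integral_mul_mul_eq_zero (memLp_two_coord f j) (fun i => hB i j)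
      (fun i k b => (hg i).freq_mul_trigCoeff k b j)
      (fun i => integrable_mul_of_memLp_two (hA i j) (hB i j))
  have h1 : HasSum (energyRate μ f g) (∑ i, ∑ j, ((∫ x, g i x j * (f x i * f x j))
      - μ * ∫ x, g i x j ^ 2)) := by
    refine hasSum_sum fun i _ => hasSum_sum fun j _ => ?_
    have := (hasSum_trigCoeff_mul (hB i j) (hA i j)).sub ((hasSum_trigCoeff_sq (hB i j)).mul_left μ)
    refine this.congr_fun fun k => ?_
    rw [Finset.mul_sum, ← Finset.sum_sub_distrib]
    refine Finset.sum_congr rfl fun b _ => ?_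
    ring
  convert! h1 using 1
  simp only [Finset.sum_sub_distrib, norm_sq_eq_integral, integral_norm_sq_eq_sum]
  rw [Finset.sum_comm (f := fun i j => ∫ x, g i x j * (f x i * f x j))]
  simp only [mul_comm (g _ _ _), h0, Finset.sum_const_zero, Finset.mul_sum, zero_sub, neg_mul,
    Finset.sum_neg_distrib]

lemma sum_trigCoeff_sq_le {h : Torus d → ℝ} (hh : MemLp h 2) (F : Finset (Fin d → ℤ)) :
    ∑ k ∈ F, ∑ b, trigCoeff k b h ^ 2 ≤ ∫ x, h x ^ 2 :=
  sum_le_hasSum F (fun _ _ => Finset.sum_nonneg fun _ _ => sq_nonneg _) (hasSum_trigCoeff_sq hh)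

/-- An upper bound for `∑ₖ |energyRate μ f g k|`. -/
noncomputable def energyRateBound (μ : ℝ) (f : L2 d) (g : Fin d → L2 d) : ℝ :=
  (1 + μ) * ∑ i, ‖g i‖ ^ 2 + ∑ _i : Fin d, ∑ _j : Fin d, (∫⁻ x, ‖f x‖ₑ ^ 4).toReal

/-- Young's inequality `|x(y - μx)| ≤ (1 + μ)x² + y²` followed by Bessel. The bound is uniform in
`F` and, along `u`, integrable in time. -/
lemma sum_abs_energyRate_le (hμ : 0 < μ) {f : L2 d} (h4 : MemLp f 4) (g : Fin d → L2 d)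
    (F : Finset (Fin d → ℤ)) : ∑ k ∈ F, |energyRate μ f g k| ≤ energyRateBound μ f g := by
  have hA := fun i j => memLp_two_mul_of_memLp_four h4 i j
  have hB := fun i j => memLp_two_coord (g i) j
  calc ∑ k ∈ F, |energyRate μ f g k|
      ≤ ∑ k ∈ F, ∑ i, ∑ j, ∑ b, ((1 + μ) * trigCoeff k b (fun x => g i x j) ^ 2
          + trigCoeff k b (fun x => f x i * f x j) ^ 2) := by
        refine Finset.sum_le_sum fun k _ => ?_
        refine (Finset.abs_sum_le_sum_abs _ _).trans (Finset.sum_le_sum fun i _ => ?_)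
        refine (Finset.abs_sum_le_sum_abs _ _).trans (Finset.sum_le_sum fun j _ => ?_)
        refine (Finset.abs_sum_le_sum_abs _ _).trans (Finset.sum_le_sum fun b _ => ?_)
        set x := trigCoeff k b (fun x => g i x j)
        set y := trigCoeff k b (fun x => f x i * f x j)
        rw [abs_le]
        constructor <;> nlinarith [sq_nonneg (x + y), sq_nonneg (x - y), mul_nonneg hμ.le (sq_nonneg x)]
    _ = ∑ i, ∑ j, ((1 + μ) * (∑ k ∈ F, ∑ b, trigCoeff k b (fun x => g i x j) ^ 2)
          + ∑ k ∈ F, ∑ b, trigCoeff k b (fun x => f x i * f x j) ^ 2) := by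
        rw [Finset.sum_comm]
        refine Finset.sum_congr rfl fun i _ => ?_
        rw [Finset.sum_comm]
        refine Finset.sum_congr rfl fun j _ => ?_
        simp only [Finset.sum_add_distrib, Finset.mul_sum]
    _ ≤ ∑ i, ∑ j, ((1 + μ) * (∫ x, g i x j ^ 2) + (∫⁻ x, ‖f x‖ₑ ^ 4).toReal) := by
        refine Finset.sum_le_sum fun i _ => Finset.sum_le_sum fun j _ => ?_
        gcongr
        · exact sum_trigCoeff_sq_le (hB i j) F
        · exact (sum_trigCoeff_sq_le (hA i j) F).trans (integral_mul_sq_le h4 i j)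
    _ = energyRateBound μ f g := by
        simp only [energyRateBound, Finset.sum_add_distrib, norm_sq_eq_integral,
          integral_norm_sq_eq_sum, Finset.mul_sum]

lemma IsWeakSolution.integrableOn_energyRateBound (hu : IsWeakSolution μ T u₀ u G)
    (h : ∫⁻ t in Ioo 0 T, ∫⁻ x, ‖u t x‖ₑ ^ 4 < ⊤) :
    IntegrableOn (fun t => energyRateBound μ (u t) (G t)) (Ioo 0 T) :=
  ((integrable_finsetSum _ fun i _ => (hu.memL2H1.grad_memLp i).norm.integrable_sq).const_mul _).add
    (integrable_finsetSum _ fun _ _ => integrable_finsetSum _ fun _ _ =>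
      integrable_toReal_of_lintegral_ne_top
        (aemeasurable_lintegral_pow_four hu.memLinftyL2) h.ne)

lemma IsWeakSolution.integrableOn_energyRate (hμ : 0 < μ) (hu : IsWeakSolution μ T u₀ u G)
    (h : ∫⁻ t in Ioo 0 T, ∫⁻ x, ‖u t x‖ₑ ^ 4 < ⊤) (k : Fin d → ℤ) :
    IntegrableOn (fun t => energyRate μ (u t) (G t) k) (Ioo 0 T) := by
  refine Integrable.mono' (hu.integrableOn_energyRateBound h) ?_ ?_
  · have hG : ∀ i j b, AEStronglyMeasurable (fun t => trigCoeff k b (fun x => G t i x j))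
        (volume.restrict (Ioo 0 T)) := fun i j b =>
      (integrableOn_trigCoeff one_le_two (hu.memL2H1.grad_memLp i) k b j).1
    exact Finset.aestronglyMeasurable_fun_sum _ fun i _ =>
      Finset.aestronglyMeasurable_fun_sum _ fun j _ =>
        Finset.aestronglyMeasurable_fun_sum _ fun b _ => (hG i j b).mul
          ((hu.memLinftyL2.integrableOn_trigCoeff_mul k b i j).1.sub ((hG i j b).const_mul μ))
  · filter_upwards [ae_memLp_four hu.memLinftyL2 h] with t ht
    simpa using sum_abs_energyRate_le hμ ht (G t) {k}

/-- The uniform bound on partial sums gives summability of the `L¹(0,t)` norms, which justifies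
exchanging the sum with the integral. -/
lemma IsWeakSolution.hasSum_integral_energyRate (hμ : 0 < μ) (hu : IsWeakSolution μ T u₀ u G)
    (h : ∫⁻ t in Ioo 0 T, ∫⁻ x, ‖u t x‖ₑ ^ 4 < ⊤) {t : ℝ} (ht : t ≤ T) :
    HasSum (fun k => ∫ τ in Ioo 0 t, energyRate μ (u τ) (G τ) k)
      (-μ * ∫ τ in Ioo 0 t, ∑ i, ‖G τ i‖ ^ 2) := by
  have hsub : Ioo 0 t ⊆ Ioo 0 T := Ioo_subset_Ioo_right ht
  have hi := fun k => (hu.integrableOn_energyRate hμ h k).mono_set hsub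
  have hB := (hu.integrableOn_energyRateBound h).mono_set hsub
  have key := hasSum_integral_of_summable_integral_norm hi ?_
  · convert! key using 1
    rw [← integral_const_mul]
    refine integral_congr_ae (ae_restrict_of_ae_restrict_of_subset hsub ?_)
    filter_upwards [ae_memLp_four hu.memLinftyL2 h, hu.divFree, hu.memL2H1.isWeakPartialDeriv]
      with τ h1 h2 h3
    exact (hasSum_energyRate h2 h1 h3).tsum_eq.symm
  · refine summable_of_sum_le (c := ∫ τ in Ioo 0 t, energyRateBound μ (u τ) (G τ))
      (fun k => integral_nonneg fun _ => norm_nonneg _) fun F => ?_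
    rw [← integral_finsetSum _ fun k _ => (hi k).norm]
    refine integral_mono_ae (integrable_finsetSum _ fun k _ => (hi k).norm) hB
      (ae_restrict_of_ae_restrict_of_subset hsub ?_)
    filter_upwards [ae_memLp_four hu.memLinftyL2 h] with τ h1
    exact sum_abs_energyRate_le hμ h1 (G τ) F

/-- At a fixed frequency the coefficients are absolutely continuous, so their squares may be
differentiated without any regularity of `∂ₜu`. -/
lemma IsWeakSolution.sum_evolvedCoeff_sq (hu : IsWeakSolution μ T u₀ u G) (hT : 0 < T)
    (k : Fin d → ℤ) {t : ℝ} (ht : t ∈ Icc 0 T) :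
    ∑ j, ∑ b, evolvedCoeff μ u₀ u G k b j t ^ 2
      = ∑ j, ∑ b, trigCoeff k b (fun x => u₀ x j) ^ 2
        + 2 * ∫ τ in Ioo 0 t, energyRate μ (u τ) (G τ) k := by
  have hsub : Ioo 0 t ⊆ Ioo 0 T := Ioo_subset_Ioo_right ht.2
  have hR : ∀ b j, IntegrableOn (fun τ => projForceCoeff μ (u τ) (G τ) k b j) (Ioo 0 t) :=
    fun b j => (hu.integrableOn_projForceCoeff k b j).mono_set hsub
  have hRI : ∀ b j, IntervalIntegrable (fun τ => projForceCoeff μ (u τ) (G τ) k b j) volume 0 t :=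
    fun b j => (intervalIntegrable_iff_integrableOn_Ioo_of_le ht.1).2 (hR b j)
  have hi : ∀ b j, IntegrableOn (fun τ => projForceCoeff μ (u τ) (G τ) k b j
      * evolvedCoeff μ u₀ u G k b j τ) (Ioo 0 t) := by
    intro b j
    rw [← intervalIntegrable_iff_integrableOn_Ioo_of_le ht.1]
    refine (hRI b j).mul_continuousOn ?_
    rw [uIcc_of_le ht.1]
    exact (hu.continuousOn_evolvedCoeff hT k b j).mono (Icc_subset_Icc_right ht.2)
  have h1 : ∀ b j, evolvedCoeff μ u₀ u G k b j t ^ 2 = trigCoeff k b (fun x => u₀ x j) ^ 2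
      + 2 * ∫ τ in Ioo 0 t, projForceCoeff μ (u τ) (G τ) k b j
        * evolvedCoeff μ u₀ u G k b j τ := by
    intro b j
    have := primitive_mul_primitive (hRI b j) (hRI b j) (trigCoeff k b (fun x => u₀ x j))
      (trigCoeff k b (fun x => u₀ x j))
    rw [intervalIntegral.integral_of_le ht.1 (f := fun t => _ + _), integral_Ioc_eq_integral_Ioo,
      ← sq, ← sq] at this
    rw [evolvedCoeff, this, ← integral_const_mul]
    congr 2
    funext τ
    rw [evolvedCoeff]
    ring
  simp only [h1, Finset.sum_add_distrib, ← Finset.mul_sum]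
  congr 2
  have h2 : ∀ j, ∑ b, ∫ τ in Ioo 0 t, projForceCoeff μ (u τ) (G τ) k b j
        * evolvedCoeff μ u₀ u G k b j τ
      = ∫ τ in Ioo 0 t, ∑ b, projForceCoeff μ (u τ) (G τ) k b j
        * evolvedCoeff μ u₀ u G k b j τ := fun j =>
    (integral_finsetSum _ fun b _ => hi b j).symm
  simp only [h2]
  rw [← integral_finsetSum _ fun j _ => integrable_finsetSum _ fun b _ => hi b j]
  refine integral_congr_ae (ae_restrict_of_ae_restrict_of_subset hsub ?_)
  filter_upwards [hu.divFree, hu.memL2H1.isWeakPartialDeriv,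
    ae_all_iff.2 fun b => ae_all_iff.2 fun j => hu.ae_trigCoeff_eq hT k b j] with τ h3 h4 h5
  rw [← sum_projForceCoeff_mul_trigCoeff h3 h4 k]
  simp only [h5]

/-- Parseval for `v t` and for `u₀`, together with the summed rates, gives two values of the same
series; they agree by uniqueness of sums. -/
lemma IsWeakSolution.energy_eq (hμ : 0 < μ) (hT : 0 < T) (hu : IsWeakSolution μ T u₀ u G)
    (h : ∫⁻ t in Ioo 0 T, ∫⁻ x, ‖u t x‖ₑ ^ 4 < ⊤) {v : ℝ → L2 d}
    (hv : IsWeaklyContinuousRep T u v) {t : ℝ} (ht : t ∈ Icc 0 T) :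
    (∫ x, ‖v t x‖ ^ 2) + 2 * μ * (∫ τ in Ioo 0 t, ∫ x, ∑ i, ‖G τ i x‖ ^ 2)
      = ∫ x, ‖u₀ x‖ ^ 2 := by
  have h1 := hasSum_trigCoeff_norm_sq (v t)
  simp only [hu.trigCoeff_rep_eq hT hv _ _ _ ht, hu.sum_evolvedCoeff_sq hT _ ht] at h1
  have h2 := (hasSum_trigCoeff_norm_sq u₀).add
    ((hu.hasSum_integral_energyRate hμ h ht.2).mul_left 2)
  have h3 : ∀ τ, ∫ x, ∑ i, ‖G τ i x‖ ^ 2 = ∑ i, ‖G τ i‖ ^ 2 := fun τ => by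
    rw [integral_finsetSum _ fun i _ => (Lp.memLp (G τ i)).norm.integrable_sq]
    simp only [norm_sq_eq_integral]
  simp only [h3]
  rw [h1.unique h2]
  ring

lemma IsWeakSolution.rep_zero_eq (hT : 0 < T) (hu : IsWeakSolution μ T u₀ u G) {v : ℝ → L2 d}
    (hv : IsWeaklyContinuousRep T u v) : v 0 = u₀ :=
  eq_of_trigCoeff_eq fun k b j => by
    rw [hu.trigCoeff_rep_eq hT hv k b j (left_mem_Icc.2 hT.le), evolvedCoeff,
      intervalIntegral.integral_same, add_zero]

end NavierStokes

theorem theorem1p1 (d : ℕ) (μ T : ℝ) (hμ : 0 < μ) (hT : 0 < T)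
    (u₀ : NavierStokes.L2 d) (u : ℝ → NavierStokes.L2 d) (G : ℝ → Fin d → NavierStokes.L2 d)
    (hu : NavierStokes.IsWeakSolution μ T u₀ u G)
    (r s : ℝ≥0∞) (hrs : 1 / r + 1 / s ≤ 1 / 2) (hs : 4 ≤ s)
    (hrsu : NavierStokes.MemLrLs T r s u) :
    (∃ v : ℝ → NavierStokes.L2 d, NavierStokes.IsWeaklyContinuousRep T u v) ∧
    ∀ v : ℝ → NavierStokes.L2 d, NavierStokes.IsWeaklyContinuousRep T u v →
      v 0 = u₀ ∧
      ∀ t ∈ Icc 0 T,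
        (∫ x, ‖v t x‖ ^ 2) + 2 * μ * (∫ τ in Ioo 0 t, ∫ x, ∑ i, ‖G τ i x‖ ^ 2)
          = ∫ x, ‖u₀ x‖ ^ 2 := by
  have h4 := NavierStokes.lintegral_lintegral_pow_four_lt_top hu.memLinftyL2 hrs hs hrsu
  exact ⟨hu.exists_isWeaklyContinuousRep hT, fun v hv =>
    ⟨hu.rep_zero_eq hT hv, fun t ht => hu.energy_eq hμ hT h4 hv ht⟩⟩
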